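/- Let $p$ be a prime. Let $T_p$ be the $p$-adic rooted tree, whose vertices are the finite words over a fixed alphabet of $p$ letters $\{1,\dots,p\}$, the empty word being the root and each word $v$ being joined to the words $vx$ for all letters $x$. Let $\mathrm{Aut}\,T_p$ be the group of graph automorphisms of $T_p$ fixing the root. For $g\in\mathrm{Aut}\,T_p$ and a vertex $v$, the label of $g$ at $v$ is the permutation $\tau$ of the alphabet such that $g$ maps $vx$ to $g(v)\tau(x)$ for every letter $x$. Let $W_p\le \mathrm{Aut}\,T_p$ be the group of $p$-adic automorphisms, i.e. of those $g$ all of whose labels are powers of the cycle $\sigma=(1\,2\,\cdots\,p)$. For $n\ge 1$ let $\mathrm{St}(n)$ be the subgroup of the elements of $W_p$ that fix every vertex of level $n$ (every word of length $n$), and give $W_p$ the congruence topology, in which the subgroups $\mathrm{St}(n)$ form a basis of neighbourhoods of the identity. The Hausdorff dimension (with respect to the level stabilizers $\mathcal S=\{\mathrm{St}(n)\}_{n\ge1}$) of a closed subgroup $K\le W_p$ is $$\mathrm{hdim}^{\mathcal S}_{W_p}(K)=\liminf_{n\to\infty}\frac{\log|K\,\mathrm{St}(n):\mathrm{St}(n)|}{\log|W_p:\mathrm{St}(n)|}.$$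 The $2$-bounded Hausdorff spectrum $\mathrm{hspec}_2^{\mathcal S}(W_p)$ is the set of the Hausdorff dimensions of all closed subgroups of $W_p$ that are topologically generated by at most $2$ elements. Then $$\mathrm{hspec}_2^{\mathcal S}(W_p)=[0,1].$$ In particular, for every $\alpha\in[0,1]$ there are $g,h\in W_p$ such that the closure of the subgroup $\langle g,h\rangle$ has Hausdorff dimension $\alpha$ in $W_p$. -/

import Mathlib

open Filter Topology

/-- The rooted `m`-adic tree: vertices are the finite words over `Fin m`, the root is the empty
word, and `u` is joined to `u ++ [x]` for every letter `x`. -/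
def regularTree (m : ℕ) : SimpleGraph (List (Fin m)) where
  Adj u v := (∃ x, v = u ++ [x]) ∨ (∃ x, u = v ++ [x])
  symm := ⟨fun _ _ h => h.symm⟩
  loopless := ⟨fun u h => by
    rcases h with ⟨x, hx⟩ | ⟨x, hx⟩ <;> simpa using congrArg List.length hx⟩

/-- The graph automorphisms of the rooted `m`-adic tree that fix the root. -/
def autTree (m : ℕ) : Subgroup (regularTree m ≃g regularTree m) where
  carrier := {g | g [] = []}
  one_mem' := rfl
  mul_mem' {a b} ha hb := by
    change a (b []) = []
    rw [show b [] = [] from hb]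
    exact ha
  inv_mem' {a} ha := by
    change a.symm [] = []
    rw [RelIso.symm_apply_eq]
    exact (show a [] = [] from ha).symm

/-- The group `Aut T_m`. -/
abbrev AutTree (m : ℕ) : Type := autTree m

namespace AutTree

variable {m : ℕ}

/-- The action of a tree automorphism on vertices. -/
def act (g : AutTree m) (v : List (Fin m)) : List (Fin m) := g.1 v

theorem act_one (v : List (Fin m)) : act 1 v = v := rfl

theorem act_mul (g h : AutTree m) (v : List (Fin m)) : act (g * h) v = act g (act h v) := rfl

theorem act_inv_act (g : AutTree m) (v : List (Fin m)) : act g⁻¹ (act g v) = v := by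
  rw [← act_mul, inv_mul_cancel, act_one]

theorem act_act_inv (g : AutTree m) (v : List (Fin m)) : act g (act g⁻¹ v) = v := by
  rw [← act_mul, mul_inv_cancel, act_one]

theorem act_nil (g : AutTree m) : act g [] = [] := g.2

theorem act_append (g : AutTree m) (v : List (Fin m)) (x : Fin m) :
    ∃ y, act g (v ++ [x]) = act g v ++ [y] := by
  have key : ∀ (u : List (Fin m)) (z : Fin m),
      (∃ y, act g (u ++ [z]) = act g u ++ [y]) ∨ (∃ y, act g u = act g (u ++ [z]) ++ [y]) :=
    fun u z => (SimpleGraph.Iso.map_adj_iff g.1).2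
      (show (regularTree m).Adj u (u ++ [z]) from Or.inl ⟨z, rfl⟩)
  induction v using List.reverseRecOn generalizing x with
  | nil =>
    rcases key [] x with h | ⟨y, hy⟩
    · exact h
    · rw [act_nil] at hy
      simpa using congrArg List.length hy
  | append_singleton v z ih =>
    rcases key (v ++ [z]) x with h | ⟨y, hy⟩
    · exact h
    · obtain ⟨y', hy'⟩ := ih z
      have h1 : act g v = act g (v ++ [z] ++ [x]) :=
        (List.append_inj' (hy'.symm.trans hy) rfl).1
      have h2 : v = v ++ [z] ++ [x] := by
        have := congrArg (act g⁻¹) h1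
        rwa [act_inv_act, act_inv_act] at this
      simpa using congrArg List.length h2

theorem length_act (g : AutTree m) (v : List (Fin m)) : (act g v).length = v.length := by
  induction v using List.reverseRecOn with
  | nil => rw [act_nil]
  | append_singleton v z ih =>
    obtain ⟨y, hy⟩ := act_append g v z
    rw [hy, List.length_append, List.length_append, ih]
    rfl

/-- `St(n)`: the automorphisms fixing every vertex at the `n`-th level. -/
def levelStabilizer (m n : ℕ) : Subgroup (AutTree m) where
  carrier := {g | ∀ v : List (Fin m), v.length = n → act g v = v}
  one_mem' _ _ := rfl
  mul_mem' {a b} ha hb v hv := by rw [act_mul, hb v hv, ha v hv]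
  inv_mem' {a} ha v hv := by
    conv_lhs => rw [← ha v hv]
    exact act_inv_act a v

instance levelStabilizer_normal (m n : ℕ) : (levelStabilizer m n).Normal where
  conj_mem g hg h v hv := by
    rw [act_mul, act_mul, hg _ (by rw [length_act, hv]), act_act_inv]

theorem levelStabilizer_antitone (m : ℕ) : Antitone (levelStabilizer m) := by
  refine antitone_nat_of_succ_le fun n g hg v hv => ?_
  rcases Nat.eq_zero_or_pos m with rfl | hm
  · have : ∀ w : List (Fin 0), w = [] := fun w => by
      cases w with
      | nil => rfl
      | cons a _ => exact a.elim0
    rw [this v, act_nil]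
  · have h := hg (v ++ [⟨0, hm⟩]) (by simp [hv])
    obtain ⟨y, hy⟩ := act_append g v ⟨0, hm⟩
    exact (List.append_inj' (hy.symm.trans h) rfl).1

/-- The level stabilizers, as a basis of neighbourhoods of the identity. -/
abbrev levelFilterBasis (m : ℕ) : GroupFilterBasis (AutTree m) where
  sets := Set.range fun n => (levelStabilizer m n : Set (AutTree m))
  nonempty := Set.range_nonempty _
  inter_sets := by
    rintro _ _ ⟨k, rfl⟩ ⟨l, rfl⟩
    exact ⟨_, ⟨max k l, rfl⟩, Set.subset_inter
      (levelStabilizer_antitone m (le_max_left k l))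
      (levelStabilizer_antitone m (le_max_right k l))⟩
  one' := by
    rintro _ ⟨n, rfl⟩
    exact one_mem (levelStabilizer m n)
  mul' := by
    rintro _ ⟨n, rfl⟩
    refine ⟨_, ⟨n, rfl⟩, ?_⟩
    rintro _ ⟨a, ha, b, hb, rfl⟩
    exact mul_mem (S := Subgroup (AutTree m)) ha hb
  inv' := by
    rintro _ ⟨n, rfl⟩
    exact ⟨_, ⟨n, rfl⟩, fun a ha => inv_mem (S := Subgroup (AutTree m)) ha⟩
  conj' g := by
    rintro _ ⟨n, rfl⟩
    exact ⟨_, ⟨n, rfl⟩, fun a ha => (levelStabilizer_normal m n).conj_mem a ha g⟩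

/-- The congruence topology on `Aut T_m`. -/
instance congruenceTopology (m : ℕ) : TopologicalSpace (AutTree m) :=
  (levelFilterBasis m).topology

instance congruenceTopology_isTopologicalGroup (m : ℕ) : IsTopologicalGroup (AutTree m) :=
  (levelFilterBasis m).isTopologicalGroup

/-- `τ` is the label of `g` at the vertex `v`: the permutation of the letters with
`g (v x) = g (v) τ(x)` for every letter `x`. -/
def IsLabel (g : AutTree m) (v : List (Fin m)) (τ : Equiv.Perm (Fin m)) : Prop :=
  ∀ x, act g (v ++ [x]) = act g v ++ [τ x]

end AutTree

/-- `W_H`: the tree automorphisms all of whose labels lie in `H`. -/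
def iteratedWreath {m : ℕ} (H : Subgroup (Equiv.Perm (Fin m))) : Subgroup (AutTree m) where
  carrier := {g | ∀ v, ∃ τ ∈ H, AutTree.IsLabel g v τ}
  one_mem' _ := ⟨1, one_mem H, fun _ => rfl⟩
  mul_mem' {a b} ha hb v := by
    obtain ⟨τ, hτ, h⟩ := hb v
    obtain ⟨ρ, hρ, h'⟩ := ha (b.act v)
    exact ⟨ρ * τ, mul_mem hρ hτ, fun x => by
      rw [AutTree.act_mul, AutTree.act_mul, h, h', Equiv.Perm.mul_apply]⟩
  inv_mem' {a} ha v := by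
    obtain ⟨τ, hτ, h⟩ := ha (AutTree.act a⁻¹ v)
    refine ⟨τ⁻¹, inv_mem hτ, fun x => ?_⟩
    have h1 := h (τ⁻¹ x)
    rw [AutTree.act_act_inv, show τ (τ⁻¹ x) = x from τ.apply_symm_apply x] at h1
    rw [← h1, AutTree.act_inv_act]

/-- The group `W_p` of `p`-adic automorphisms: all labels are powers of the cycle
`(0 1 … p-1)`. -/
def pAdicAut (p : ℕ) : Subgroup (AutTree p) :=
  iteratedWreath (Subgroup.zpowers (finRotate p))

/-- The level stabilizers `St_G(n) = St(n) ∩ G` of a group `G` of tree automorphisms. -/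
def levelFiltration {m : ℕ} (G : Subgroup (AutTree m)) (n : ℕ) : Subgroup G :=
  (AutTree.levelStabilizer m n).subgroupOf G

/-- The Hausdorff dimension of a subgroup `K` with respect to a filtration `F` by normal
subgroups of finite index: `liminf log |K F_n : F_n| / log |G : F_n|`. -/
noncomputable def hausdorffDim {G : Type*} [Group G] (F : ℕ → Subgroup G) (K : Subgroup G) : ℝ :=
  liminf (fun n => Real.log ((F n).relIndex (K ⊔ F n) : ℝ) / Real.log ((F n).index : ℝ)) atTop

/-- The `b`-bounded Hausdorff spectrum of `G` with respect to `F`: the set of the Hausdorff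
dimensions of the closed subgroups topologically generated by at most `b` elements. -/
def boundedHausdorffSpectrum {G : Type*} [Group G] [TopologicalSpace G] [IsTopologicalGroup G]
    (F : ℕ → Subgroup G) (b : ℕ) : Set ℝ :=
  {α | ∃ K : Subgroup G, IsClosed (K : Set G) ∧
    (∃ S : Finset G, S.card ≤ b ∧ (Subgroup.closure (S : Set G)).topologicalClosure = K) ∧
    hausdorffDim F K = α}

set_option linter.unusedSectionVars false

/-! Since all labels lie in a cyclic group of order `p`, the logarithm of `|K St(n) : St(n)|` is the
sum over `N < n` of the logarithms of the orders of `labelGroup K N`, and for the whole group each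
summand is `p ^ N * log p`. By the Stolz–Cesàro criterion `tendsto_div_of_increments` it is enough
to find a two-generator group whose label group of level `N` has order `p` to the power `(α + o(1))
p ^ N`. Passing to the closure changes nothing (`hausdorffDim_topologicalClosure`), and that every
dimension lies in `[0,1]` is immediate.

Write `α` in base `p` with digits `d`. The words that first deviate downwards from `d` form a
prefix-free set `S`, and the cylinders over `S` have total measure `α`. Both generators act only
below `S`, so every element of the group is a graft over `S`, and `card_labelGroup_le` gives the
upper bound.

For the lower bound, `genA` acts as the odometer below each word of `S`, while `genB` carries below
each `v` in `S` infinitely many blocks. Block `t` has two sites: a label element sits at one, the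
odometer at the other. The sites are chosen arithmetically so that conjugation by `genA ^ siteShift
p t` brings the label site of block `t` onto its odometer site and no other two sites into
comparable position. Thus the commutator of `genB` with that conjugate is concentrated at one site,
below one word of `S` (`single_commutator_mem`).

The label element is a sparse spine whose labels occur only every `h` levels. Its commutator with a
suitable power of the odometer lies in `St(n)` and has just two nonzero labels of level `n`, a basis
vector minus its translate (`commutator_spineAut`). Conjugates by powers of `genA` spread this over
the level, so below each `v` a proportion `1 - p ^ (1 - h)` of the label coordinates is attained. As
`idx` is surjective, every triple of a word, a spacing `h` and a residue has a block, so `h` and the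
finite part of `S` used can grow without changing the group. -/

namespace PAdicAut

open scoped commutatorElement

/-! ### Automorphisms as label functions -/

variable {p : ℕ} [NeZero p]

theorem finRotate_pow_apply (n : ℕ) (x : Fin p) : (finRotate p ^ n) x = x + Fin.ofNat p n := by
  induction n with
  | zero => ext; simp
  | succ n ih =>
    rw [pow_succ', Equiv.Perm.mul_apply, ih, finRotate_apply, add_assoc]
    congr 1
    ext
    simp [Fin.val_add]

/-- The cycle is translation by one on `ℤ/p`, so its powers are the translations; finiteness makes
nonnegative exponents sufficient. -/
theorem mem_zpowers_finRotate (τ : Equiv.Perm (Fin p)) :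
    τ ∈ Subgroup.zpowers (finRotate p) ↔ ∃ y, ∀ x, τ x = x + y := by
  rw [← mem_powers_iff_mem_zpowers]
  constructor
  · rintro ⟨k, rfl⟩
    exact ⟨_, finRotate_pow_apply k⟩
  · rintro ⟨y, hy⟩
    refine ⟨y.val, Equiv.ext fun x => ?_⟩
    rw [finRotate_pow_apply, hy, Fin.ofNat_val_eq_self]

/-- The action on words of the automorphism with the labels `l`. -/
def portraitAct : (List (Fin p) → Fin p) → List (Fin p) → List (Fin p)
  | _, [] => []
  | l, x :: w => (x + l []) :: portraitAct (fun v => l (x :: v)) w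

/-- The inverse of `portraitAct l`. -/
def portraitInv : (List (Fin p) → Fin p) → List (Fin p) → List (Fin p)
  | _, [] => []
  | l, y :: w => (y - l []) :: portraitInv (fun v => l ((y - l []) :: v)) w

theorem portraitInv_act (l : List (Fin p) → Fin p) (w : List (Fin p)) :
    portraitInv l (portraitAct l w) = w := by
  induction w generalizing l with
  | nil => rfl
  | cons x w ih => simp [portraitAct, portraitInv, ih]

theorem portraitAct_inv (l : List (Fin p) → Fin p) (w : List (Fin p)) :
    portraitAct l (portraitInv l w) = w := by
  induction w generalizing l with
  | nil => rfl
  | cons x w ih => simp [portraitAct, portraitInv, ih]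

theorem portraitAct_append_singleton (l : List (Fin p) → Fin p) (w : List (Fin p)) (x : Fin p) :
    portraitAct l (w ++ [x]) = portraitAct l w ++ [x + l w] := by
  induction w generalizing l with
  | nil => rfl
  | cons y w ih => simp [portraitAct, ih]

theorem portraitAct_adj_iff (l : List (Fin p) → Fin p) (u v : List (Fin p)) :
    (regularTree p).Adj (portraitAct l u) (portraitAct l v) ↔ (regularTree p).Adj u v := by
  have key : ∀ u v : List (Fin p),
      (∃ x, portraitAct l v = portraitAct l u ++ [x]) ↔ ∃ x, v = u ++ [x] := by
    intro u v
    constructor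
    · rintro ⟨x, hx⟩
      refine ⟨x - l u, ?_⟩
      have h : portraitAct l v = portraitAct l (u ++ [x - l u]) := by
        rw [portraitAct_append_singleton, hx, sub_add_cancel]
      rw [← portraitInv_act l v, h, portraitInv_act]
    · rintro ⟨x, rfl⟩
      exact ⟨_, portraitAct_append_singleton l u x⟩
  exact or_congr (key u v) (key v u)

/-- The `p`-adic automorphism with prescribed labels. -/
def ofPortrait (l : List (Fin p) → Fin p) : pAdicAut p :=
  ⟨⟨⟨⟨portraitAct l, portraitInv l, portraitInv_act l, portraitAct_inv l⟩,
      portraitAct_adj_iff l _ _⟩, rfl⟩, fun v => ⟨Equiv.addRight (l v),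
        (mem_zpowers_finRotate _).2 ⟨l v, fun _ => rfl⟩, portraitAct_append_singleton l v⟩⟩

/-- The action of a `p`-adic automorphism on words. -/
def ap (g : pAdicAut p) (w : List (Fin p)) : List (Fin p) := AutTree.act g.1 w

theorem ap_one (w : List (Fin p)) : ap 1 w = w := rfl

theorem ap_mul (g h : pAdicAut p) (w : List (Fin p)) : ap (g * h) w = ap g (ap h w) := rfl

theorem ap_nil (g : pAdicAut p) : ap g [] = [] := g.1.2

theorem ap_inv_ap (g : pAdicAut p) (w : List (Fin p)) : ap g⁻¹ (ap g w) = w :=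
  AutTree.act_inv_act g.1 w

theorem ap_ap_inv (g : pAdicAut p) (w : List (Fin p)) : ap g (ap g⁻¹ w) = w :=
  AutTree.act_act_inv g.1 w

theorem length_ap (g : pAdicAut p) (w : List (Fin p)) : (ap g w).length = w.length :=
  AutTree.length_act g.1 w

theorem ap_injective (g : pAdicAut p) : Function.Injective (ap g) :=
  Function.LeftInverse.injective (ap_inv_ap g)

theorem ext_ap {g h : pAdicAut p} (H : ∀ w, ap g w = ap h w) : g = h :=
  Subtype.ext (Subtype.ext (RelIso.ext H))

theorem ap_inv_eq_iff {g : pAdicAut p} {v w : List (Fin p)} : ap g⁻¹ v = w ↔ v = ap g w :=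
  ⟨fun h => by rw [← h, ap_ap_inv], fun h => by rw [h, ap_inv_ap]⟩

theorem exists_label (g : pAdicAut p) (v : List (Fin p)) :
    ∃ y, ∀ x, ap g (v ++ [x]) = ap g v ++ [x + y] := by
  obtain ⟨τ, hτ, h⟩ := g.2 v
  obtain ⟨y, hy⟩ := (mem_zpowers_finRotate τ).1 hτ
  exact ⟨y, fun x => by rw [← hy x]; exact h x⟩

/-- The label of `g` at `v`, as the amount by which the letters are shifted. -/
noncomputable def lab (g : pAdicAut p) (v : List (Fin p)) : Fin p := (exists_label g v).choose

theorem ap_append_singleton (g : pAdicAut p) (v : List (Fin p)) (x : Fin p) :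
    ap g (v ++ [x]) = ap g v ++ [x + lab g v] := (exists_label g v).choose_spec x

theorem lab_eq {g : pAdicAut p} {v : List (Fin p)} {x y : Fin p}
    (h : ap g (v ++ [x]) = ap g v ++ [x + y]) : lab g v = y := by
  rw [ap_append_singleton] at h
  simpa using h

theorem lab_one (v : List (Fin p)) : lab 1 v = 0 :=
  lab_eq (x := 0) (by simp [ap_one])

/-- This cocycle rule becomes additive at vertices fixed by `h`, which makes level labels a
homomorphism on `St(N)`. -/
theorem lab_mul (g h : pAdicAut p) (v : List (Fin p)) :
    lab (g * h) v = lab h v + lab g (ap h v) :=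
  lab_eq (x := 0) (by rw [ap_mul, ap_append_singleton, ap_append_singleton, ap_mul, add_assoc])

theorem lab_inv (g : pAdicAut p) (v : List (Fin p)) : lab g⁻¹ v = -lab g (ap g⁻¹ v) := by
  have h := lab_mul g g⁻¹ v
  rw [mul_inv_cancel, lab_one] at h
  exact eq_neg_of_add_eq_zero_left h.symm

theorem lab_inv_ap (g : pAdicAut p) (v : List (Fin p)) : lab g⁻¹ (ap g v) = -lab g v := by
  rw [lab_inv, ap_inv_ap]

theorem ap_ofPortrait (l : List (Fin p) → Fin p) (w : List (Fin p)) :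
    ap (ofPortrait l) w = portraitAct l w := rfl

theorem lab_ofPortrait (l : List (Fin p) → Fin p) (v : List (Fin p)) :
    lab (ofPortrait l) v = l v :=
  lab_eq (x := 0) (portraitAct_append_singleton l v 0)

theorem prefix_ap (g : pAdicAut p) {u w : List (Fin p)} (h : u <+: w) : ap g u <+: ap g w := by
  obtain ⟨t, rfl⟩ := h
  induction t using List.reverseRecOn with
  | nil => simp
  | append_singleton t x ih =>
    rw [← List.append_assoc, ap_append_singleton]
    exact ih.trans (List.prefix_append _ _)

/-- Two automorphisms with the same labels on all proper prefixes of `w` agree at `w`. -/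
theorem ap_congr {g h : pAdicAut p} {w : List (Fin p)}
    (H : ∀ v, v <+: w → v ≠ w → lab g v = lab h v) : ap g w = ap h w := by
  induction w using List.reverseRecOn with
  | nil => rw [ap_nil, ap_nil]
  | append_singleton w x ih =>
    rw [ap_append_singleton, ap_append_singleton, H w (List.prefix_append _ _) (by simp), ih]
    intro v hv hne
    refine H v (hv.trans (List.prefix_append _ _)) ?_
    rintro rfl
    simpa using hv.length_le

/-- `g` lies in `St(n)` iff its labels above level `n` vanish. -/
theorem mem_level_iff {g : pAdicAut p} {n : ℕ} :
    g ∈ levelFiltration (pAdicAut p) n ↔ ∀ v, v.length < n → lab g v = 0 := by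
  constructor
  · intro h v hv
    have h1 : ∀ m ≤ n, ∀ w : List (Fin p), w.length = m → ap g w = w := fun m hm w hw =>
      AutTree.levelStabilizer_antitone p hm h w hw
    refine lab_eq (x := 0) ?_
    rw [h1 (v.length + 1) hv _ (by simp), h1 _ hv.le v rfl, add_zero]
  · intro h w hw
    have : ap g w = ap 1 w := ap_congr fun v hv hne => by
      rw [lab_one, h v]
      rw [← hw]
      exact lt_of_le_of_ne hv.length_le fun he => hne (hv.eq_of_length he)
    exact this

theorem ap_eq_of_mem_level {g : pAdicAut p} {n : ℕ} (h : g ∈ levelFiltration (pAdicAut p) n)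
    {w : List (Fin p)} (hw : w.length ≤ n) : ap g w = w :=
  AutTree.levelStabilizer_antitone p hw h w rfl

/-- Automorphisms moving disjoint sets of words commute. -/
theorem commute_of_disjoint {g h : pAdicAut p} (H : ∀ w, ap g w = w ∨ ap h w = w) :
    Commute g h := by
  refine ext_ap fun w => ?_
  rw [ap_mul, ap_mul]
  rcases H w with hg | hh
  · rcases H (ap h w) with h1 | h1
    · rw [h1, hg]
    · have := ap_injective h h1
      rw [this, hg, this]
  · rcases H (ap g w) with h1 | h1
    · have := ap_injective g h1
      rw [hh, this, hh]
    · rw [h1, hh]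

/-! ### Prefix-free sets and grafts -/

/-- No word of `S` is a proper prefix of another one. -/
def PrefixFree (S : Set (List (Fin p))) : Prop := ∀ u ∈ S, ∀ v ∈ S, u <+: v → u = v

theorem PrefixFree.mono {S T : Set (List (Fin p))} (hT : PrefixFree T) (h : S ⊆ T) :
    PrefixFree S := fun u hu v hv => hT u (h hu) v (h hv)

theorem prefixFree_singleton (x : List (Fin p)) : PrefixFree {x} := by
  rintro u rfl v rfl _
  rfl

theorem PrefixFree.eq_of_prefix {S : Set (List (Fin p))} (hS : PrefixFree S)
    {u v w : List (Fin p)} (hu : u ∈ S) (hv : v ∈ S) (huw : u <+: w) (hvw : v <+: w) : u = v := by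
  rcases le_total u.length v.length with h | h
  · exact hS u hu v hv (List.prefix_of_prefix_length_le huw hvw h)
  · exact (hS v hv u hu (List.prefix_of_prefix_length_le hvw huw h)).symm

open Classical in
/-- The automorphism acting as `c u` on the subtree below each `u ∈ S`, and trivially off these
subtrees. -/
noncomputable def graft (S : Set (List (Fin p))) (c : List (Fin p) → pAdicAut p) : pAdicAut p :=
  ofPortrait fun w =>
    if h : ∃ u ∈ S, u <+: w then lab (c h.choose) (w.drop h.choose.length) else 0

theorem lab_graft_of_forall_not {S : Set (List (Fin p))} {c : List (Fin p) → pAdicAut p}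
    {w : List (Fin p)} (h : ∀ u ∈ S, ¬ u <+: w) : lab (graft S c) w = 0 := by
  rw [graft, lab_ofPortrait, dif_neg]
  rintro ⟨u, hu, huw⟩
  exact h u hu huw

/-- Prefix-freeness makes the prefix picked by choice in `graft` unique. -/
theorem lab_graft_append {S : Set (List (Fin p))} (hS : PrefixFree S)
    (c : List (Fin p) → pAdicAut p) {u : List (Fin p)} (hu : u ∈ S) (w : List (Fin p)) :
    lab (graft S c) (u ++ w) = lab (c u) w := by
  have h : ∃ v ∈ S, v <+: u ++ w := ⟨u, hu, List.prefix_append _ _⟩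
  have h1 : h.choose = u :=
    hS.eq_of_prefix h.choose_spec.1 hu h.choose_spec.2 (List.prefix_append _ _)
  rw [graft, lab_ofPortrait, dif_pos h, h1, List.drop_left]

theorem ap_graft_of_forall {S : Set (List (Fin p))} {c : List (Fin p) → pAdicAut p}
    {w : List (Fin p)} (h : ∀ u ∈ S, u <+: w → u = w) : ap (graft S c) w = w := by
  have : ap (graft S c) w = ap 1 w := ap_congr fun v hv hne => by
    rw [lab_one, lab_graft_of_forall_not]
    intro u hu huv
    have h1 := h u hu (huv.trans hv)
    subst h1
    exact hne (hv.eq_of_length (le_antisymm hv.length_le huv.length_le))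
  exact this

theorem ap_graft_append {S : Set (List (Fin p))} (hS : PrefixFree S)
    (c : List (Fin p) → pAdicAut p) {u : List (Fin p)} (hu : u ∈ S) (w : List (Fin p)) :
    ap (graft S c) (u ++ w) = u ++ ap (c u) w := by
  induction w using List.reverseRecOn with
  | nil =>
    rw [ap_nil, List.append_nil]
    exact ap_graft_of_forall fun v hv h => hS v hv u hu h
  | append_singleton w x ih =>
    rw [← List.append_assoc, ap_append_singleton, ih, lab_graft_append hS c hu,
      ap_append_singleton, List.append_assoc]

theorem ap_graft_of_forall_not {S : Set (List (Fin p))} {c : List (Fin p) → pAdicAut p}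
    {w : List (Fin p)} (h : ∀ u ∈ S, ¬ u <+: w) : ap (graft S c) w = w :=
  ap_graft_of_forall fun u hu huw => absurd huw (h u hu)

/-- An automorphism is a graft if it acts like one. -/
theorem eq_graft {S : Set (List (Fin p))} (hS : PrefixFree S) {c : List (Fin p) → pAdicAut p}
    {g : pAdicAut p} (h1 : ∀ u ∈ S, ∀ w, ap g (u ++ w) = u ++ ap (c u) w)
    (h2 : ∀ w, (∀ u ∈ S, ¬ u <+: w) → ap g w = w) : g = graft S c := by
  refine ext_ap fun w => ?_
  by_cases h : ∃ u ∈ S, u <+: w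
  · obtain ⟨u, hu, t, rfl⟩ := h
    rw [h1 u hu, ap_graft_append hS c hu]
  · push Not at h
    rw [h2 w h, ap_graft_of_forall_not h]

theorem graft_mul {S : Set (List (Fin p))} (hS : PrefixFree S) (c d : List (Fin p) → pAdicAut p) :
    graft S c * graft S d = graft S (c * d) := by
  refine eq_graft hS (fun u hu w => ?_) fun w hw => ?_
  · rw [ap_mul, ap_graft_append hS d hu, ap_graft_append hS c hu, Pi.mul_apply, ap_mul]
  · rw [ap_mul, ap_graft_of_forall_not hw, ap_graft_of_forall_not hw]

/-- `graft S` as a homomorphism. -/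
noncomputable def graftHom {S : Set (List (Fin p))} (hS : PrefixFree S) :
    (List (Fin p) → pAdicAut p) →* pAdicAut p :=
  MonoidHom.mk' (graft S) fun c d => (graft_mul hS c d).symm

theorem graftHom_apply {S : Set (List (Fin p))} (hS : PrefixFree S)
    (c : List (Fin p) → pAdicAut p) : graftHom hS c = graft S c := rfl

/-- The automorphism acting as `y` on the subtree below `x` and trivially elsewhere. -/
noncomputable def single (x : List (Fin p)) (y : pAdicAut p) : pAdicAut p := graft {x} fun _ => y

theorem ap_single_append (x w : List (Fin p)) (y : pAdicAut p) :
    ap (single x y) (x ++ w) = x ++ ap y w :=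
  ap_graft_append (prefixFree_singleton x) _ rfl w

theorem ap_single_of_not {x w : List (Fin p)} {y : pAdicAut p} (h : ¬ x <+: w) :
    ap (single x y) w = w :=
  ap_graft_of_forall_not (by rintro u rfl; exact h)

theorem lab_single_append (x w : List (Fin p)) (y : pAdicAut p) :
    lab (single x y) (x ++ w) = lab y w :=
  lab_graft_append (prefixFree_singleton x) _ rfl w

theorem lab_single_of_not {x w : List (Fin p)} {y : pAdicAut p} (h : ¬ x <+: w) :
    lab (single x y) w = 0 :=
  lab_graft_of_forall_not (by rintro u rfl; exact h)

/-- `single x` as a homomorphism. -/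
noncomputable def singleHom (x : List (Fin p)) : pAdicAut p →* pAdicAut p :=
  MonoidHom.mk' (single x) fun _ _ => (graft_mul (prefixFree_singleton x) _ _).symm

theorem singleHom_apply (x : List (Fin p)) (y : pAdicAut p) : singleHom x y = single x y := rfl

theorem eq_single {x : List (Fin p)} {y g : pAdicAut p}
    (h1 : ∀ w, ap g (x ++ w) = x ++ ap y w) (h2 : ∀ w, ¬ x <+: w → ap g w = w) :
    g = single x y :=
  eq_graft (prefixFree_singleton x) (by rintro u rfl w; exact h1 w) fun w hw => h2 w (hw x rfl)

theorem single_single (x y : List (Fin p)) (g : pAdicAut p) :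
    single x (single y g) = single (x ++ y) g := by
  refine eq_single (fun w => ?_) fun w hw => ?_
  · rw [List.append_assoc, ap_single_append, ap_single_append, List.append_assoc]
  · by_cases hx : x <+: w
    · obtain ⟨t, rfl⟩ := hx
      rw [ap_single_append, ap_single_of_not]
      rwa [List.prefix_append_right_inj] at hw
    · rw [ap_single_of_not hx]

theorem graft_eq_single {S : Set (List (Fin p))} (hS : PrefixFree S)
    {c : List (Fin p) → pAdicAut p} {x : List (Fin p)} (hx : x ∈ S)
    (h : ∀ u ∈ S, u ≠ x → c u = 1) : graft S c = single x (c x) := by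
  refine eq_single (fun w => ap_graft_append hS c hx w) fun w hw => ?_
  by_cases hu : ∃ u ∈ S, u <+: w
  · obtain ⟨u, hu, t, rfl⟩ := hu
    rw [ap_graft_append hS c hu, h u hu, ap_one]
    rintro rfl
    exact hw (List.prefix_append _ _)
  · push Not at hu
    exact ap_graft_of_forall_not hu

theorem graft_eq_single_mul {S : Set (List (Fin p))} (hS : PrefixFree S)
    (c : List (Fin p) → pAdicAut p) {x : List (Fin p)} (hx : x ∈ S) :
    graft S c = single x (c x) * graft (S \ {x}) c := by
  symm
  have hS' : PrefixFree (S \ {x}) := hS.mono Set.sdiff_subset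
  refine eq_graft hS (fun u hu w => ?_) fun w hw => ?_
  · by_cases hux : u = x
    · subst hux
      rw [ap_mul, ap_graft_of_forall_not, ap_single_append]
      rintro v ⟨hv, hne⟩ hvu
      exact hne (hS.eq_of_prefix hv hu hvu (List.prefix_append _ _))
    · rw [ap_mul, ap_graft_append hS' c ⟨hu, hux⟩, ap_single_of_not]
      exact fun h => hux (hS.eq_of_prefix hu hx (List.prefix_append _ _) h)
  · rw [ap_mul, ap_graft_of_forall_not fun u hu => hw u hu.1, ap_single_of_not (hw x hx)]

/-- Used with `h = 1` to move a section from one site to another, and with `x = x'` to conjugate a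
section in place. -/
theorem conj_single {g h : pAdicAut p} {x x' : List (Fin p)}
    (H : ∀ w, ap g (x ++ w) = x' ++ ap h w) (y : pAdicAut p) :
    g * single x y * g⁻¹ = single x' (h * y * h⁻¹) := by
  have hx' : ∀ w, ap g⁻¹ (x' ++ w) = x ++ ap h⁻¹ w := fun w => by
    rw [ap_inv_eq_iff, H, ap_ap_inv]
  refine eq_single (fun w => ?_) fun w hw => ?_
  · simp only [ap_mul]
    rw [hx', ap_single_append, H]
  · rw [ap_mul, ap_mul, ap_single_of_not, ap_ap_inv]
    rintro ⟨t, ht⟩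
    apply hw
    rw [← ap_ap_inv g w, ← ht, H]
    exact List.prefix_append _ _

/-- A graft over `U` commutes with a conjugate by `g` of a graft over `V` if all words of `U` are
incomparable to those of `g V`. -/
theorem commute_graft_conj {U V : Set (List (Fin p))} {c d : List (Fin p) → pAdicAut p}
    {g : pAdicAut p} (H : ∀ u ∈ U, ∀ v ∈ V, ¬ u <+: ap g v ∧ ¬ ap g v <+: u) :
    Commute (graft U c) (g * graft V d * g⁻¹) := by
  refine commute_of_disjoint fun w => ?_
  by_contra! h
  have h1 : ∃ u ∈ U, u <+: w := by
    by_contra! h1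
    exact h.1 (ap_graft_of_forall_not h1)
  have h2 : ∃ v ∈ V, v <+: ap g⁻¹ w := by
    by_contra! h2
    apply h.2
    rw [ap_mul, ap_mul, ap_graft_of_forall_not h2, ap_ap_inv]
  obtain ⟨u, hu, huw⟩ := h1
  obtain ⟨v, hv, hvw⟩ := h2
  have h3 := prefix_ap g hvw
  rw [ap_ap_inv] at h3
  rcases le_total u.length (ap g v).length with hl | hl
  · exact (H u hu v hv).1 (List.prefix_of_prefix_length_le huw h3 hl)
  · exact (H u hu v hv).2 (List.prefix_of_prefix_length_le h3 huw hl)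

/-! ### Words as numbers in base `p`, and the odometer -/

/-- The word of length `n` given by the lowest `n` digits of `q` in base `p`. -/
def word (p : ℕ) [NeZero p] : ℕ → ℕ → List (Fin p)
  | 0, _ => []
  | n + 1, q => Fin.ofNat p q :: word p n (q / p)

theorem length_word (n q : ℕ) : (word p n q).length = n := by
  induction n generalizing q with
  | zero => rfl
  | succ n ih => simp [word, ih]

/-- The lowest digit comes first, so comparability of words turns into congruence modulo a power of
`p`. -/
theorem word_eq_word_iff {n q r : ℕ} : word p n q = word p n r ↔ q ≡ r [MOD p ^ n] := by
  have hp : 0 < p := NeZero.pos p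
  induction n generalizing q r with
  | zero => simp [word, Nat.modEq_one]
  | succ n ih =>
    simp only [word, List.cons.injEq, ih, Fin.ext_iff, Fin.val_ofNat]
    unfold Nat.ModEq
    rw [pow_succ', Nat.mod_mul, Nat.mod_mul]
    constructor
    · rintro ⟨h1, h2⟩
      rw [h1, h2]
    · intro h
      have h1 : q % p = r % p := by
        have := congrArg (· % p) h
        simpa [Nat.add_mul_mod_self_left] using this
      refine ⟨h1, ?_⟩
      rw [h1] at h
      exact Nat.eq_of_mul_eq_mul_left hp (Nat.add_left_cancel h)

theorem exists_eq_word (u : List (Fin p)) : ∃ q < p ^ u.length, u = word p u.length q := by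
  have hp : 0 < p := NeZero.pos p
  induction u with
  | nil => exact ⟨0, by simp, rfl⟩
  | cons x u ih =>
    obtain ⟨q, hq, h⟩ := ih
    refine ⟨x.val + p * q, ?_, ?_⟩
    · rw [List.length_cons, pow_succ']
      calc x.val + p * q < p + p * q := by have := x.2; omega
        _ = p * (q + 1) := by ring
        _ ≤ p * p ^ u.length := Nat.mul_le_mul_left p hq
    · simp only [List.length_cons, word, List.cons.injEq]
      refine ⟨?_, ?_⟩
      · ext
        simp [Nat.mod_eq_of_lt x.2]
      · rw [Nat.add_mul_div_left _ _ hp, Nat.div_eq_of_lt x.2, zero_add]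
        exact h

theorem word_add (m n q : ℕ) : word p (m + n) q = word p m q ++ word p n (q / p ^ m) := by
  induction m generalizing q with
  | zero => simp [word]
  | succ m ih =>
    rw [Nat.add_right_comm, word, ih, word, List.cons_append, Nat.div_div_eq_div_mul, pow_succ']

theorem word_prefix {m n : ℕ} (h : m ≤ n) (q : ℕ) : word p m q <+: word p n q := by
  obtain ⟨k, rfl⟩ := Nat.exists_eq_add_of_le h
  rw [word_add]
  exact List.prefix_append _ _

theorem modEq_of_word_prefix {m n q r : ℕ} (h : word p m q <+: word p n r) :
    q ≡ r [MOD p ^ m] := by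
  have hl := h.length_le
  rw [length_word, length_word] at hl
  rw [← word_eq_word_iff]
  exact (List.prefix_of_prefix_length_le h (word_prefix hl r)
    (by rw [length_word, length_word])).eq_of_length (by rw [length_word, length_word])

/-- The odometer. -/
def odometer (p : ℕ) [NeZero p] : pAdicAut p :=
  ofPortrait fun w => if ∀ x ∈ w, x.val + 1 = p then Fin.ofNat p 1 else 0

theorem portraitAct_zero (w : List (Fin p)) : portraitAct (fun _ => 0) w = w := by
  induction w with
  | nil => rfl
  | cons x w ih => simp [portraitAct, ih]

theorem ap_odometer_cons (x : Fin p) (w : List (Fin p)) :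
    ap (odometer p) (x :: w) =
      (x + Fin.ofNat p 1) :: if x.val + 1 = p then ap (odometer p) w else w := by
  rw [odometer, ap_ofPortrait, portraitAct, ap_ofPortrait]
  simp only [List.not_mem_nil, false_implies, implies_true, if_true, List.mem_cons,
    forall_eq_or_imp]
  congr 1
  split_ifs with h
  · simp [h]
  · simp [h, portraitAct_zero]

/-- The odometer adds one with carry; the carry reaches `w` exactly when the first `n` digits
overflow. -/
theorem ap_odometer_word (n q : ℕ) (w : List (Fin p)) :
    ap (odometer p) (word p n q ++ w) =
      word p n (q + 1) ++ if p ^ n ∣ q + 1 then ap (odometer p) w else w := by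
  have hp : 0 < p := NeZero.pos p
  induction n generalizing q with
  | zero => simp [word]
  | succ n ih =>
    have hx : Fin.ofNat p q + Fin.ofNat p 1 = Fin.ofNat p (q + 1) := by
      ext; simp [Fin.val_add]
    rw [word, List.cons_append, ap_odometer_cons, hx, word, List.cons_append, Fin.val_ofNat]
    congr 1
    have hlt := Nat.mod_lt q hp
    have hdm := Nat.div_add_mod q p
    split_ifs with h1 h2 h2
    · have h3 : q + 1 = p * (q / p + 1) := by rw [mul_add]; omega
      rw [ih, h3, Nat.mul_div_cancel_left _ hp, if_pos]
      rw [h3, pow_succ'] at h2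
      exact Nat.dvd_of_mul_dvd_mul_left hp h2
    · have h3 : q + 1 = p * (q / p + 1) := by rw [mul_add]; omega
      rw [ih, h3, Nat.mul_div_cancel_left _ hp, if_neg]
      rw [h3, pow_succ'] at h2
      exact fun h => h2 (Nat.mul_dvd_mul_left p h)
    · exfalso
      obtain ⟨k, hk⟩ := (Dvd.intro_left _ (pow_succ p n).symm).trans h2
      have : (q + 1) % p = 0 := by rw [hk]; simp
      rw [Nat.add_mod] at this
      rcases Nat.lt_or_ge 1 p with h | h
      · rw [Nat.mod_eq_of_lt h, Nat.mod_eq_of_lt (by omega)] at this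
        omega
      · omega
    · have h3 : (q + 1) / p = q / p := by
        rw [Nat.div_eq_iff hp]
        constructor
        · have := mul_comm p (q / p); omega
        · have := mul_comm p (q / p); omega
      rw [h3]

theorem ap_odometer_pow_word (s n q : ℕ) :
    ap (odometer p ^ s) (word p n q) = word p n (q + s) := by
  induction s with
  | zero => rfl
  | succ s ih =>
    rw [pow_succ', ap_mul, ih]
    have := ap_odometer_word n (q + s) ([] : List (Fin p))
    simpa [ap_nil, add_assoc] using this

theorem ap_odometer_pow_word_append {s n q : ℕ} (h : q + s < p ^ n) (w : List (Fin p)) :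
    ap (odometer p ^ s) (word p n q ++ w) = word p n (q + s) ++ w := by
  induction s with
  | zero => rfl
  | succ s ih =>
    rw [pow_succ', ap_mul, ih (by omega), ap_odometer_word, if_neg, add_assoc]
    exact fun hd => absurd (Nat.le_of_dvd (by omega) hd) (by omega)

/-- A full turn of `p ^ n` steps returns to `u` and overflows exactly once. -/
theorem ap_odometer_pow_pow (n : ℕ) {u : List (Fin p)} (hu : u.length = n) (w : List (Fin p)) :
    ap (odometer p ^ p ^ n) (u ++ w) = u ++ ap (odometer p) w := by
  obtain ⟨q, hq, h⟩ := exists_eq_word u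
  rw [hu] at hq h
  have h1 : p ^ n = q + (p ^ n - 1 - q + 1) := by omega
  -- Count up to `p ^ n - 1`, make the one step with a carry, which lands at zero, then count up to
  -- `q` again.
  rw [h, h1, pow_add, pow_succ', ap_mul, ap_mul, ap_odometer_pow_word_append (by omega),
    ap_odometer_word, if_pos (by rw [show q + (p ^ n - 1 - q) + 1 = p ^ n by omega]),
    show word p n (q + (p ^ n - 1 - q) + 1) = word p n 0 from
      word_eq_word_iff.2 (by rw [show q + (p ^ n - 1 - q) + 1 = p ^ n by omega]; simp [Nat.ModEq]),
    ap_odometer_pow_word_append (by omega), zero_add]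

theorem ap_odometer_pow_mul (n c : ℕ) {u : List (Fin p)} (hu : u.length = n) (w : List (Fin p)) :
    ap (odometer p ^ (p ^ n * c)) (u ++ w) = u ++ ap (odometer p ^ c) w := by
  induction c with
  | zero => rfl
  | succ c ih =>
    rw [Nat.mul_succ, add_comm, pow_add, ap_mul, ih, ap_odometer_pow_pow n hu, pow_succ', ap_mul]

/-! ### The sites and their separation -/

/-- A single term of lowest `p`-adic valuation cannot cancel. -/
theorem pow_modEq_false {p e M a b d : ℕ} (hp : 2 ≤ p) (h : a + b ≡ p ^ e + d [MOD p ^ M])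
    (hM : e + 1 ≤ M) (ha : p ^ (e + 1) ∣ a) (hb : p ^ (e + 1) ∣ b) (hd : p ^ (e + 1) ∣ d) :
    False := by
  have h1 : p ^ (e + 1) ∣ p ^ e + d :=
    (h.dvd_iff (pow_dvd_pow p hM)).1 (dvd_add ha hb)
  have h2 := (Nat.pow_dvd_pow_iff_le_right (by omega : 1 < p)).1 ((Nat.dvd_add_left hd).1 h1)
  omega

/-- Each side has one odd and one even exponent, so unless the indices agree some term has strictly
lowest exponent, below the exponent of the modulus. When `r = t` the even powers cancel first. -/
theorem eq_of_pow_modEq {p s t r : ℕ} (hp : 2 ≤ p)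
    (h : p ^ (2 * s + 3) + p ^ (2 * t + 2) ≡ p ^ (2 * r + 2) + p ^ (2 * t + 3)
      [MOD p ^ min (2 * s + 4) (2 * r + 4)]) : s = t ∧ r = t := by
  have h' := h.symm
  by_contra hn
  have hd : ∀ {i j : ℕ}, i ≤ j → p ^ i ∣ p ^ j := fun hij => pow_dvd_pow p hij
  rcases lt_trichotomy r t with hr | rfl | hr
  · rcases le_or_gt r s with hs | hs
    · exact pow_modEq_false hp h (by omega) (hd (by omega)) (hd (by omega)) (hd (by omega))
    · exact pow_modEq_false hp h' (by omega) (hd (by omega)) (hd (by omega)) (hd (by omega))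
  · have h1 := Nat.ModEq.add_left_cancel' (p ^ (2 * r + 2)) (add_comm (p ^ (2 * s + 3)) _ ▸ h)
    have h2 : p ^ (2 * s + 3) + 0 ≡ p ^ (2 * r + 3) + 0 [MOD p ^ min (2 * s + 4) (2 * r + 4)] := h1
    rcases lt_trichotomy r s with hs | rfl | hs
    · exact pow_modEq_false hp h2 (by omega) (hd (by omega)) (dvd_zero _) (dvd_zero _)
    · exact hn ⟨rfl, rfl⟩
    · exact pow_modEq_false hp h2.symm (by omega) (hd (by omega)) (dvd_zero _) (dvd_zero _)
  · rcases le_or_gt t s with hs | hs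
    · rw [add_comm (p ^ (2 * s + 3))] at h'
      exact pow_modEq_false hp h' (by omega) (hd (by omega)) (hd (by omega)) (hd (by omega))
    · exact pow_modEq_false hp h' (by omega) (hd (by omega)) (hd (by omega)) (hd (by omega))

/-- The site of the block `t` carrying the label element. -/
def labelSite (p : ℕ) [NeZero p] (t : ℕ) : List (Fin p) := word p (2 * t + 4) (p ^ (2 * t + 2))

/-- The site of the block `t` carrying the odometer. -/
def odometerSite (p : ℕ) [NeZero p] (t : ℕ) : List (Fin p) :=
  word p (2 * t + 4) (1 + p ^ (2 * t + 3))

/-- The power of the odometer moving `labelSite p t` to `odometerSite p t`. -/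
def siteShift (p t : ℕ) : ℕ := 1 + p ^ (2 * t + 3) - p ^ (2 * t + 2)

theorem length_labelSite (t : ℕ) : (labelSite p t).length = 2 * t + 4 := length_word _ _

theorem length_odometerSite (t : ℕ) : (odometerSite p t).length = 2 * t + 4 := length_word _ _

theorem add_siteShift (hp : 2 ≤ p) (t : ℕ) :
    p ^ (2 * t + 2) + siteShift p t = 1 + p ^ (2 * t + 3) := by
  have := Nat.pow_le_pow_right (show 0 < p by omega) (show 2 * t + 2 ≤ 2 * t + 3 by omega)
  rw [siteShift]
  omega

theorem odometer_pow_siteShift (hp : 2 ≤ p) (t : ℕ) (w : List (Fin p)) :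
    ap (odometer p ^ siteShift p t) (labelSite p t ++ w) = odometerSite p t ++ w := by
  have h1 : p ^ (2 * t + 4) = p * p ^ (2 * t + 3) := pow_succ' p _
  have h2 : 2 * p ^ (2 * t + 3) ≤ p * p ^ (2 * t + 3) := Nat.mul_le_mul_right _ hp
  have h3 := Nat.one_lt_pow (show 2 * t + 3 ≠ 0 by omega) (show 1 < p by omega)
  rw [labelSite, ap_odometer_pow_word_append, add_siteShift hp, odometerSite]
  rw [add_siteShift hp]
  omega

theorem four_le_sq (hp : 2 ≤ p) : 4 ≤ p ^ 2 := by nlinarith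

theorem siteShift_modEq (hp : 2 ≤ p) (t : ℕ) : siteShift p t ≡ 1 [MOD p ^ 2] := by
  have h := add_siteShift hp t
  have h1 : p ^ (2 * t + 2) ≡ 0 [MOD p ^ 2] :=
    (Nat.modEq_zero_iff_dvd).2 (pow_dvd_pow p (by omega))
  have h2 : p ^ (2 * t + 3) ≡ 0 [MOD p ^ 2] :=
    (Nat.modEq_zero_iff_dvd).2 (pow_dvd_pow p (by omega))
  have h3 := (h1.symm.add_right (siteShift p t)).trans (h ▸ h2.add_left 1)
  simpa using h3

/-- Comparable words have congruent numbers. -/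
theorem modEq_of_comparable {m n q r : ℕ}
    (h : word p m q <+: word p n r ∨ word p n r <+: word p m q) : q ≡ r [MOD p ^ min m n] := by
  rcases h with h | h
  · exact (modEq_of_word_prefix h).of_dvd (pow_dvd_pow p (min_le_left _ _))
  · exact (modEq_of_word_prefix h).symm.of_dvd (pow_dvd_pow p (min_le_right _ _))

/-- The sites of the blocks in `T`. -/
def sites (p : ℕ) [NeZero p] (T : Set ℕ) : Set (List (Fin p)) :=
  {u | ∃ t ∈ T, u = labelSite p t ∨ u = odometerSite p t}

theorem pow_modEq_zero {e : ℕ} (he : 2 ≤ e) : p ^ e ≡ 0 [MOD p ^ 2] :=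
  (Nat.modEq_zero_iff_dvd).2 (pow_dvd_pow p he)

theorem not_modEq_of_lt (hp : 2 ≤ p) {i j : ℕ} (hi : i < 4) (hj : j < 4) (hij : i ≠ j) :
    ¬ i ≡ j [MOD p ^ 2] := fun h =>
  hij (h.eq_of_lt_of_lt (hi.trans_le (four_le_sq hp)) (hj.trans_le (four_le_sq hp)))

/-- The numbers of label sites are `0` and those of odometer sites `1` modulo `p ^ 2`. -/
theorem labelSite_not_comparable_odometerSite (hp : 2 ≤ p) (s t : ℕ) :
    ¬ (labelSite p s <+: odometerSite p t ∨ odometerSite p t <+: labelSite p s) := fun h => by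
  have h1 := (modEq_of_comparable h).of_dvd (pow_dvd_pow p (show 2 ≤ _ by omega))
  refine not_modEq_of_lt hp (by omega) (by omega) (by omega : 0 ≠ 1)
    (((pow_modEq_zero (by omega)).symm.trans h1).trans
      ((pow_modEq_zero (p := p) (by omega : 2 ≤ 2 * t + 3)).add_left 1))

theorem labelSite_prefix (hp : 2 ≤ p) {s t : ℕ} (h : labelSite p s <+: labelSite p t) : s = t := by
  have hl := h.length_le
  rw [length_labelSite, length_labelSite] at hl
  by_contra hst
  have h1 : 0 + p ^ (2 * t + 2) ≡ p ^ (2 * s + 2) + 0 [MOD p ^ (2 * s + 4)] := by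
    simpa using (modEq_of_word_prefix h).symm
  exact pow_modEq_false hp h1 (by omega) (dvd_zero _) (pow_dvd_pow p (by omega)) (dvd_zero _)

theorem odometerSite_prefix (hp : 2 ≤ p) {s t : ℕ} (h : odometerSite p s <+: odometerSite p t) :
    s = t := by
  have hl := h.length_le
  rw [length_odometerSite, length_odometerSite] at hl
  by_contra hst
  have h1 : 0 + p ^ (2 * t + 3) ≡ p ^ (2 * s + 3) + 0 [MOD p ^ (2 * s + 4)] := by
    simpa using (Nat.ModEq.add_left_cancel' 1 (modEq_of_word_prefix h)).symm
  exact pow_modEq_false hp h1 (by omega) (dvd_zero _) (pow_dvd_pow p (by omega)) (dvd_zero _)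

theorem prefixFree_sites (hp : 2 ≤ p) (T : Set ℕ) : PrefixFree (sites p T) := by
  rintro _ ⟨s, -, rfl | rfl⟩ _ ⟨t, -, rfl | rfl⟩ h
  · rw [labelSite_prefix hp h]
  · exact absurd (Or.inl h) (labelSite_not_comparable_odometerSite hp s t)
  · exact absurd (Or.inr h) (labelSite_not_comparable_odometerSite hp t s)
  · rw [odometerSite_prefix hp h]

/-- The only site moved by `siteShift p t` to a word comparable with a site is `labelSite p t`. -/
theorem eq_of_comparable_shift (hp : 2 ≤ p) {t : ℕ} {T : Set ℕ} {u v : List (Fin p)}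
    (hu : u ∈ sites p T) (hv : v ∈ sites p T)
    (h : u <+: ap (odometer p ^ siteShift p t) v ∨ ap (odometer p ^ siteShift p t) v <+: u) :
    t ∈ T ∧ u = odometerSite p t ∧ v = labelSite p t := by
  obtain ⟨s, hs, hu⟩ := hu
  obtain ⟨r, hr, hv⟩ := hv
  have hone := siteShift_modEq hp t
  have hadd := add_siteShift hp t
  have h2 : 2 ≤ min (2 * s + 4) (2 * r + 4) := by omega
  rcases hu with rfl | rfl <;> rcases hv with rfl | rfl
  all_goals
    simp only [labelSite, odometerSite, ap_odometer_pow_word] at h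
    replace h := modEq_of_comparable h
    have h' := h.of_dvd (pow_dvd_pow p h2)
  -- Modulo `p ^ 2` the shift adds `1`, so a shifted label site becomes `1` and a shifted odometer
  -- site `2`. As `p ^ 2` is at least `4`, only a shifted label site can meet an odometer site.
  · exact absurd (((pow_modEq_zero (by omega)).symm.trans h').trans
      ((pow_modEq_zero (by omega)).add hone))
      (not_modEq_of_lt hp (by omega) (by omega) (by omega : 0 ≠ 0 + 1))
  · exact absurd (((pow_modEq_zero (by omega)).symm.trans h').trans
      (((pow_modEq_zero (by omega)).add_left 1).add hone))
      (not_modEq_of_lt hp (by omega) (by omega) (by omega : 0 ≠ 1 + 0 + 1))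
  · have h3 : p ^ (2 * s + 3) + p ^ (2 * t + 2) ≡ p ^ (2 * r + 2) + p ^ (2 * t + 3)
        [MOD p ^ min (2 * s + 4) (2 * r + 4)] := by
      have h4 := h.add_right (p ^ (2 * t + 2))
      rw [add_assoc (p ^ (2 * r + 2)), add_comm (siteShift p t), hadd] at h4
      refine Nat.ModEq.add_left_cancel' 1 ?_
      convert h4 using 1 <;> ring
    obtain ⟨rfl, rfl⟩ := eq_of_pow_modEq hp h3
    exact ⟨hs, rfl, rfl⟩
  · exact absurd ((((pow_modEq_zero (by omega)).add_left 1).symm.trans h').trans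
      (((pow_modEq_zero (by omega)).add_left 1).add hone))
      (not_modEq_of_lt hp (by omega) (by omega) (by omega : 1 + 0 ≠ 1 + 0 + 1))

/-! ### Commutators isolating one block -/

theorem commutator_mul_mul {G : Type*} [Group G] {a b c d : G} (h1 : Commute b c)
    (h2 : Commute b d) (h3 : Commute a d) : ⁅a * b, c * d⁆ = ⁅a, c⁆ := by
  have h4 : Commute b (c * d) := h1.mul_right h2
  rw [commutatorElement_def, commutatorElement_def, mul_assoc a b, h4.eq, mul_inv_rev, mul_inv_rev]
  calc a * (c * d * b) * (b⁻¹ * a⁻¹) * (d⁻¹ * c⁻¹) = a * c * (d * a⁻¹) * d⁻¹ * c⁻¹ := by group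
    _ = a * c * (a⁻¹ * d) * d⁻¹ * c⁻¹ := by rw [h3.inv_left.eq]
    _ = a * c * a⁻¹ * c⁻¹ := by group

/-- The sections at the sites: `b t` at `labelSite p t`, the odometer at `odometerSite p t`. -/
noncomputable def siteSection (b : ℕ → pAdicAut p) (u : List (Fin p)) : pAdicAut p :=
  if u = labelSite p ((u.length - 4) / 2) then b ((u.length - 4) / 2) else odometer p

theorem siteSection_labelSite (b : ℕ → pAdicAut p) (t : ℕ) :
    siteSection b (labelSite p t) = b t := by
  have : ((labelSite p t).length - 4) / 2 = t := by rw [length_labelSite]; omega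
  rw [siteSection, this, if_pos rfl]

theorem siteSection_odometerSite (hp : 2 ≤ p) (b : ℕ → pAdicAut p) (t : ℕ) :
    siteSection b (odometerSite p t) = odometer p := by
  have : ((odometerSite p t).length - 4) / 2 = t := by rw [length_odometerSite]; omega
  rw [siteSection, this, if_neg]
  intro h
  exact labelSite_not_comparable_odometerSite hp t t (Or.inl (h ▸ List.prefix_rfl))

/-- The automorphism with the sections `siteSection b` at the sites of the blocks in `T`. -/
noncomputable def blockAut (b : ℕ → pAdicAut p) (T : Set ℕ) : pAdicAut p :=
  graft (sites p T) (siteSection b)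

/-- Split off the odometer of block `t` from the first factor and the moved section `b t` from the
second. By `eq_of_comparable_shift` all other pairs of pieces have disjoint supports and commute. -/
theorem commutator_blockAut_of_mem (hp : 2 ≤ p) (b : ℕ → pAdicAut p) {T : Set ℕ} {t : ℕ}
    (ht : t ∈ T) :
    ⁅blockAut b T, odometer p ^ siteShift p t * blockAut b T * (odometer p ^ siteShift p t)⁻¹⁆ =
      single (odometerSite p t) ⁅odometer p, b t⁆ := by
  have hS := prefixFree_sites hp T
  have hx : odometerSite p t ∈ sites p T := ⟨t, ht, Or.inr rfl⟩
  have hy : labelSite p t ∈ sites p T := ⟨t, ht, Or.inl rfl⟩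
  have h1 : blockAut b T = single (odometerSite p t) (odometer p) *
      graft (sites p T \ {odometerSite p t}) (siteSection b) := by
    rw [blockAut, graft_eq_single_mul hS _ hx, siteSection_odometerSite hp]
  have h2 : blockAut b T = single (labelSite p t) (b t) *
      graft (sites p T \ {labelSite p t}) (siteSection b) := by
    rw [blockAut, graft_eq_single_mul hS _ hy, siteSection_labelSite]
  set g := odometer p ^ siteShift p t with hg
  have h3 : g * single (labelSite p t) (b t) * g⁻¹ = single (odometerSite p t) (b t) := by
    rw [conj_single (h := 1) (fun w => odometer_pow_siteShift hp t w), one_mul, inv_one, mul_one]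
  have h4 : g * blockAut b T * g⁻¹ = single (odometerSite p t) (b t) *
      (g * graft (sites p T \ {labelSite p t}) (siteSection b) * g⁻¹) := by
    rw [← h3]
    nth_rewrite 1 [h2]
    group
  have h5 : ∀ u ∈ sites p T, ∀ v ∈ sites p T, (u ≠ odometerSite p t ∨ v ≠ labelSite p t) →
      ¬ u <+: ap g v ∧ ¬ ap g v <+: u := by
    intro u hu v hv hne
    rw [← not_or]
    intro h
    have h6 := eq_of_comparable_shift hp hu hv h
    tauto
  rw [h4]
  nth_rewrite 1 [h1]
  rw [commutator_mul_mul, ← singleHom_apply, ← singleHom_apply, ← singleHom_apply,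
    map_commutatorElement]
  · rw [← h3]
    refine commute_graft_conj fun u hu v hv => ?_
    obtain rfl : v = labelSite p t := hv
    exact h5 u hu.1 _ hy (Or.inl hu.2)
  · exact commute_graft_conj fun u hu v hv => h5 u hu.1 v hv.1 (Or.inl hu.2)
  · refine commute_graft_conj fun u hu v hv => ?_
    obtain rfl : u = odometerSite p t := hu
    exact h5 _ hx v hv.1 (Or.inr hv.2)

/-- This silences all words of `S` except the one to which block `t` belongs. -/
theorem commutator_blockAut_of_notMem (hp : 2 ≤ p) (b : ℕ → pAdicAut p) {T : Set ℕ} {t : ℕ}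
    (ht : t ∉ T) :
    ⁅blockAut b T, odometer p ^ siteShift p t * blockAut b T * (odometer p ^ siteShift p t)⁻¹⁆ =
      1 := by
  rw [commutatorElement_eq_one_iff_commute]
  refine commute_graft_conj fun u hu v hv => ?_
  rw [← not_or]
  exact fun h => ht (eq_of_comparable_shift hp hu hv h).1

/-! ### Spines and generators of a level -/

theorem lab_conj (g h : pAdicAut p) (u : List (Fin p)) :
    lab (g * h * g⁻¹) (ap g u) = lab h u + lab g (ap h u) - lab g u := by
  rw [lab_mul, lab_inv_ap, ap_inv_ap, lab_mul]
  abel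

theorem ap_pow_append {g h : pAdicAut p} {v : List (Fin p)}
    (H : ∀ w, ap g (v ++ w) = v ++ ap h w) (i : ℕ) (w : List (Fin p)) :
    ap (g ^ i) (v ++ w) = v ++ ap (h ^ i) w := by
  induction i with
  | zero => rfl
  | succ i ih => rw [pow_succ', pow_succ', ap_mul, ap_mul, ih, H]

/-- The automorphism whose nontrivial labels are at the words of zeros whose length lies in a
fixed residue class modulo `h`. -/
noncomputable def spineAut (p : ℕ) [NeZero p] (m h j : ℕ) : pAdicAut p :=
  ofPortrait fun w =>
    if w = List.replicate w.length 0 ∧ (m + w.length) % h = j then Fin.ofNat p 1 else 0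

theorem lab_spineAut (m h j : ℕ) (w : List (Fin p)) :
    lab (spineAut p m h j) w =
      if w = List.replicate w.length 0 ∧ (m + w.length) % h = j then Fin.ofNat p 1 else 0 :=
  lab_ofPortrait _ _

theorem lab_spineAut_eq_zero {m h j n : ℕ} (hn : (m + n) % h = j) (hnh : h ≤ n + 1)
    {w : List (Fin p)} (h1 : n + 1 - h ≤ w.length) (h2 : w.length < n) :
    lab (spineAut p m h j) w = 0 := by
  rw [lab_spineAut, if_neg]
  rintro ⟨-, h3⟩
  rw [← hn] at h3
  have h4 : m + w.length ≡ m + n [MOD h] := h3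
  have h5 := (Nat.modEq_iff_dvd' h2.le).1 (Nat.ModEq.add_left_cancel' m h4)
  have := Nat.le_of_dvd (by omega) h5
  omega

/-- The nonzero label before level `n` nearest to it can only be at level `n - h`, so down to level
`n` only the first `n + 1 - h` letters are changed. -/
theorem ap_spineAut_append {m h j n : ℕ} (hn : (m + n) % h = j) (hnh : h ≤ n + 1)
    {u : List (Fin p)} (hu : u.length = n + 1 - h) (w : List (Fin p))
    (hw : u.length + w.length ≤ n) :
    ap (spineAut p m h j) (u ++ w) = ap (spineAut p m h j) u ++ w := by
  induction w using List.reverseRecOn with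
  | nil => simp
  | append_singleton w x ih =>
    rw [List.length_append, List.length_singleton] at hw
    rw [← List.append_assoc, ap_append_singleton, ih (by omega),
      lab_spineAut_eq_zero hn hnh (by simp [hu]) (by rw [List.length_append]; omega), add_zero,
      List.append_assoc]

theorem odometer_pow_mem_level (k : ℕ) :
    odometer p ^ p ^ k ∈ levelFiltration (pAdicAut p) k := fun u hu => by
  have := ap_odometer_pow_pow k hu ([] : List (Fin p))
  rwa [ap_nil, List.append_nil] at this

theorem lab_odometer_pow_append {k : ℕ} {u : List (Fin p)} (hu : u.length = k)
    (w : List (Fin p)) : lab (odometer p ^ p ^ k) (u ++ w) = lab (odometer p) w :=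
  lab_eq (x := 0) (by
    rw [List.append_assoc, ap_odometer_pow_pow k hu, ap_odometer_pow_pow k hu,
      ap_append_singleton, List.append_assoc])

/-- A level-`n` generator: a commutator in `St(n)` with two nontrivial labels of level `n`. -/
theorem commutator_spineAut {m h j n : ℕ} (hn : (m + n) % h = j) (hnh : h ≤ n + 1) :
    ∃ z : List (Fin p), z.length = n ∧
      ⁅odometer p ^ p ^ (n + 1 - h), spineAut p m h j⁆ ∈ levelFiltration (pAdicAut p) n ∧
      ∀ w : List (Fin p), w.length = n →
        lab ⁅odometer p ^ p ^ (n + 1 - h), spineAut p m h j⁆ w =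
          (if w = ap (odometer p ^ p ^ (n + 1 - h)) z then Fin.ofNat p 1 else 0) -
            if w = z then Fin.ofNat p 1 else 0 := by
  set k := n + 1 - h with hk
  set g := odometer p ^ p ^ k with hg
  set b := spineAut p m h j with hb
  have hgl : g ∈ levelFiltration (pAdicAut p) k := odometer_pow_mem_level k
  -- Down to level `n`, `b` acts on the first `k` letters alone, whereas `g` fixes those and acts on
  -- the rest independently of them.
  have hcomm : ∀ u : List (Fin p), u.length ≤ n → ap b (ap g u) = ap g (ap b u) := by
    intro u hu
    rcases le_total u.length k with h1 | h1
    · rw [ap_eq_of_mem_level hgl h1, ap_eq_of_mem_level hgl (by rwa [length_ap])]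
    · have h2 : (u.take k).length = k := List.length_take_of_le h1
      have h3 : k + (u.drop k).length ≤ n := by rw [List.length_drop]; omega
      rw [← List.take_append_drop k u, ap_odometer_pow_pow k h2,
        ap_spineAut_append hn hnh h2 _ (by rw [length_ap, h2]; exact h3),
        ap_spineAut_append hn hnh h2 _ (by rw [h2]; exact h3),
        ap_odometer_pow_pow k (by rw [length_ap, h2])]
  have hlab : ∀ u : List (Fin p), u.length ≤ n → lab g (ap b u) = lab g u := by
    intro u hu
    rcases lt_or_ge u.length k with h1 | h1
    · rw [mem_level_iff.1 hgl _ h1, mem_level_iff.1 hgl _ (by rwa [length_ap])]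
    · have h2 : (u.take k).length = k := List.length_take_of_le h1
      have h3 : k + (u.drop k).length ≤ n := by rw [List.length_drop]; omega
      rw [← List.take_append_drop k u,
        ap_spineAut_append hn hnh h2 _ (by rw [h2]; exact h3),
        lab_odometer_pow_append h2, lab_odometer_pow_append (by rw [length_ap, h2])]
  have key : ∀ u : List (Fin p), u.length ≤ n →
      lab ⁅g, b⁆ (ap b (ap g u)) = lab b u - lab b (ap g u) := by
    intro u hu
    rw [commutatorElement_def, lab_mul, lab_inv_ap, ap_inv_ap, lab_conj, hlab u hu]
    abel
  have surj : ∀ w : List (Fin p), ∃ u, u.length = w.length ∧ ap b (ap g u) = w := fun w =>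
    ⟨ap g⁻¹ (ap b⁻¹ w), by rw [length_ap, length_ap], by rw [ap_ap_inv, ap_ap_inv]⟩
  -- By `key`, nonzero terms come from `u = 0 ^ n` and from `g u = 0 ^ n`, that is, at the words `b
  -- (g (0 ^ n)) = g z` and `b (0 ^ n) = z`.
  refine ⟨ap b (List.replicate n 0), by rw [length_ap, List.length_replicate],
    mem_level_iff.2 fun w hw => ?_, fun w hw => ?_⟩
  · obtain ⟨u, hu, rfl⟩ := surj w
    rw [hu.symm] at hw
    rw [key u hw.le]
    rcases le_total u.length k with h1 | h1
    · rw [ap_eq_of_mem_level hgl h1, sub_self]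
    · rw [lab_spineAut_eq_zero hn hnh h1 hw,
        lab_spineAut_eq_zero hn hnh (by rwa [length_ap]) (by rwa [length_ap]), sub_zero]
  · obtain ⟨u, hu, rfl⟩ := surj w
    rw [hw] at hu
    rw [key u hu.le, lab_spineAut, lab_spineAut, length_ap, hu, ← hcomm _ (by simp)]
    simp only [hn, and_true, (ap_injective b).eq_iff, (ap_injective g).eq_iff]

theorem single_mem_level {x : List (Fin p)} {y : pAdicAut p} {n : ℕ}
    (hy : y ∈ levelFiltration (pAdicAut p) n) :
    single x y ∈ levelFiltration (pAdicAut p) (x.length + n) := by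
  rw [mem_level_iff] at hy ⊢
  intro w hw
  by_cases hx : x <+: w
  · obtain ⟨t, rfl⟩ := hx
    rw [lab_single_append]
    rw [List.length_append] at hw
    exact hy t (by omega)
  · exact lab_single_of_not hx

/-! ### The two generators -/

section Generators

variable (S : Set (List (Fin p))) (idx : ℕ → List (Fin p) × ℕ × ℕ)

/-- The element acting as the odometer below each word of `S`. -/
noncomputable def genA : pAdicAut p := graft S fun _ => odometer p

/-- The label elements of the blocks. -/
noncomputable def blockLabel (t : ℕ) : pAdicAut p :=
  spineAut p (2 * t + 4) (idx t).2.1 (idx t).2.2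

/-- The element with the blocks indexed by `v` below each word `v` of `S`. -/
noncomputable def genB : pAdicAut p :=
  graft S fun v => blockAut (blockLabel idx) {t | (idx t).1 = v}

variable {S idx} {K : Subgroup (pAdicAut p)} (hp : 2 ≤ p) (hS : PrefixFree S)
  (hA : genA S ∈ K) (hB : genB S idx ∈ K)

include hp hS hA hB in
-- The commutator is computed separately below each word of `S`; only the word owning block `t`
-- contributes.
theorem single_commutator_mem {t : ℕ} (hv : (idx t).1 ∈ S) :
    single ((idx t).1 ++ odometerSite p t) ⁅odometer p, blockLabel idx t⁆ ∈ K := by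
  have h1 : ⁅genB S idx, genA S ^ siteShift p t * genB S idx * (genA S ^ siteShift p t)⁻¹⁆ ∈ K := by
    have hc := mul_mem (mul_mem (pow_mem hA (siteShift p t)) hB)
      (inv_mem (pow_mem hA (siteShift p t)))
    rw [commutatorElement_def]
    exact mul_mem (mul_mem (mul_mem hB hc) (inv_mem hB)) (inv_mem hc)
  rw [genA, genB, ← graftHom_apply hS, ← graftHom_apply hS, ← map_pow, ← map_mul, ← map_inv,
    ← map_mul, ← map_commutatorElement, graftHom_apply, graft_eq_single hS hv] at h1
  · have h2 : ∀ (c d : List (Fin p) → pAdicAut p) v, ⁅c, d⁆ v = ⁅c v, d v⁆ := fun _ _ _ => rfl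
    rw [← single_single, ← commutator_blockAut_of_mem hp _ (T := {r | (idx r).1 = (idx t).1}) rfl]
    exact h1
  · intro v _ hne
    exact commutator_blockAut_of_notMem hp _ (T := {r | (idx r).1 = v}) fun h => hne h.symm

include hS in
theorem ap_genA_pow {v : List (Fin p)} (hv : v ∈ S) (i : ℕ) (w : List (Fin p)) :
    ap (genA S ^ i) (v ++ w) = v ++ ap (odometer p ^ i) w :=
  ap_pow_append (fun w => ap_graft_append hS _ hv w) i w

include hp hS hA hB in
-- `genA ^ p ^ (2 * t + 4)` acts as the odometer below the site, so the identity `⁅a ^ (k + 1), b⁆ =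
-- a ⁅a ^ k, b⁆ a⁻¹ ⁅a, b⁆` can be realised inside `K`.
theorem single_commutator_pow_mem {t : ℕ} (hv : (idx t).1 ∈ S) (k : ℕ) :
    single ((idx t).1 ++ odometerSite p t) ⁅odometer p ^ k, blockLabel idx t⁆ ∈ K := by
  have h0 := single_commutator_mem hp hS hA hB hv
  induction k with
  | zero =>
    rw [pow_zero, commutatorElement_one_left, ← singleHom_apply, map_one]
    exact one_mem K
  | succ k ih =>
    have h1 : ⁅odometer p ^ (k + 1), blockLabel idx t⁆ =
        odometer p * ⁅odometer p ^ k, blockLabel idx t⁆ * (odometer p)⁻¹ *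
          ⁅odometer p, blockLabel idx t⁆ := by
      simp only [commutatorElement_def, pow_succ']
      group
    have h2 : ∀ w, ap (genA S ^ p ^ (2 * t + 4)) ((idx t).1 ++ odometerSite p t ++ w) =
        (idx t).1 ++ odometerSite p t ++ ap (odometer p) w := fun w => by
      rw [List.append_assoc, ap_genA_pow hS hv, ap_odometer_pow_pow _ (length_odometerSite t),
        List.append_assoc]
    rw [h1, ← singleHom_apply, map_mul, singleHom_apply, singleHom_apply, ← conj_single h2]
    have h3 := pow_mem hA (p ^ (2 * t + 4))
    exact mul_mem (mul_mem (mul_mem h3 ih) (inv_mem h3)) h0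

include hp hS hA hB in
/-- Far down below `v ∈ S`, any two words that are exchanged by a large power of the odometer are
the support of the level-`N` labels of some element of `K ∩ St(N)`. -/
theorem exists_mem_level_lab (hidx : Function.Surjective idx) {v : List (Fin p)} (hv : v ∈ S)
    {h : ℕ} (hh : 0 < h) :
    ∃ N₀ : ℕ, ∀ N ≥ N₀, ∀ u : List (Fin p), v.length + u.length = N →
      ∃ g ∈ K, g ∈ levelFiltration (pAdicAut p) N ∧ ∀ w : List (Fin p), w.length = N →
        lab g w = (if w = v ++ ap (odometer p ^ p ^ (u.length + 1 - h)) u then Fin.ofNat p 1 else 0)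
          - if w = v ++ u then Fin.ofNat p 1 else 0 := by
  choose τ hτ using fun j => hidx (v, h, j)
  -- One block per residue modulo `h` serves all levels; the bound puts level `N` at least `h` below
  -- the site of whichever block is used.
  refine ⟨v.length + ∑ j ∈ Finset.range h, (2 * τ j + 4) + h, fun N hN u hu => ?_⟩
  set t := τ (u.length % h) with ht
  have h1 : 2 * t + 4 ≤ ∑ j ∈ Finset.range h, (2 * τ j + 4) :=
    Finset.single_le_sum (f := fun j => 2 * τ j + 4) (fun _ _ => Nat.zero_le _)
      (Finset.mem_range.2 (Nat.mod_lt _ hh))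
  obtain ⟨n, hn⟩ := Nat.exists_eq_add_of_le (show 2 * t + 4 ≤ u.length by omega)
  have hti : idx t = (v, h, u.length % h) := hτ _
  obtain ⟨z, hz, hy, hlab⟩ := commutator_spineAut (p := p) (m := 2 * t + 4) (j := u.length % h)
    (by rw [hn]) (show h ≤ n + 1 by omega)
  have hmem := single_commutator_pow_mem hp hS hA hB (t := t) (by rw [hti]; exact hv)
    (p ^ (n + 1 - h))
  rw [blockLabel, hti] at hmem
  set y := ⁅odometer p ^ p ^ (n + 1 - h), spineAut p (2 * t + 4) h (u.length % h)⁆ with hydef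
  set x := odometerSite p t with hx
  have hxl : x.length = 2 * t + 4 := length_odometerSite t
  have hlev : single (v ++ x) y ∈ levelFiltration (pAdicAut p) N := by
    have := single_mem_level (x := v ++ x) hy
    rwa [List.length_append, hxl, add_assoc, ← hn, hu] at this
  -- Transitivity of the odometer on a level: subtract one number modulo `p ^ u.length` and add the
  -- other.
  obtain ⟨i, hi⟩ : ∃ i, ap (odometer p ^ i) (x ++ z) = u := by
    obtain ⟨q, hq, hu'⟩ := exists_eq_word u
    obtain ⟨r, hr, hz'⟩ := exists_eq_word (x ++ z)
    have hl : (x ++ z).length = u.length := by rw [List.length_append, hxl, hz, hn]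
    rw [hl] at hr hz'
    refine ⟨p ^ u.length - r + q, ?_⟩
    rw [hz', ap_odometer_pow_word]
    conv_rhs => rw [hu']
    rw [word_eq_word_iff, ← add_assoc, Nat.add_sub_cancel' hr.le]
    simp [Nat.ModEq]
  have hA' := pow_mem hA i
  have hfix : ∀ w : List (Fin p), w.length = N → ap (single (v ++ x) y) w = w := fun w hw =>
    ap_eq_of_mem_level hlev hw.le
  have hsl : ∀ w : List (Fin p), w.length = N → lab (single (v ++ x) y) w =
      (if w = v ++ ap (odometer p ^ p ^ (u.length + 1 - h)) (x ++ z) then Fin.ofNat p 1 else 0)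
        - if w = v ++ (x ++ z) then Fin.ofNat p 1 else 0 := by
    intro w hw
    have h2 : p ^ (u.length + 1 - h) = p ^ (2 * t + 4) * p ^ (n + 1 - h) := by
      rw [← pow_add]
      congr 1
      omega
    rw [h2, ap_odometer_pow_mul _ _ hxl, ← List.append_assoc, ← List.append_assoc]
    by_cases hxw : v ++ x <+: w
    · obtain ⟨s, rfl⟩ := hxw
      rw [List.length_append, List.length_append, hxl] at hw
      rw [lab_single_append, hlab s (by omega)]
      simp only [List.append_cancel_left_eq]
    · rw [lab_single_of_not hxw, if_neg, if_neg, sub_zero]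
      · rintro rfl
        exact hxw (List.prefix_append _ _)
      · rintro rfl
        exact hxw (List.prefix_append _ _)
  refine ⟨genA S ^ i * single (v ++ x) y * (genA S ^ i)⁻¹,
    mul_mem (mul_mem hA' hmem) (inv_mem hA'),
    (Subgroup.Normal.subgroupOf (AutTree.levelStabilizer_normal p N) _).conj_mem _ hlev _,
    fun w hw => ?_⟩
  obtain ⟨w', hw', rfl⟩ : ∃ w', w'.length = N ∧ ap (genA S ^ i) w' = w :=
    ⟨ap (genA S ^ i)⁻¹ w, by rw [length_ap, hw], ap_ap_inv _ _⟩
  have hc : ∀ r, ap (genA S ^ i) (v ++ ap (odometer p ^ r) (x ++ z)) =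
      v ++ ap (odometer p ^ r) u := fun r => by
    rw [ap_genA_pow hS hv, ← ap_mul, ← pow_add, add_comm, pow_add, ap_mul, hi]
  have hc0 : ap (genA S ^ i) (v ++ (x ++ z)) = v ++ u := by rw [ap_genA_pow hS hv, hi]
  -- The element fixes level `N`, so conjugation merely transports its labels.
  rw [lab_conj, hfix w' hw', add_sub_cancel_right, hsl w' hw', ← hc, ← hc0]
  simp only [(ap_injective _).eq_iff]

end Generators

/-! ### Indices and orders of label groups -/

instance levelFiltration_normal (N : ℕ) : (levelFiltration (pAdicAut p) N).Normal :=
  Subgroup.Normal.subgroupOf (AutTree.levelStabilizer_normal p N) _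

theorem levelFiltration_antitone : Antitone (levelFiltration (pAdicAut p)) := fun _ _ h _ hg =>
  AutTree.levelStabilizer_antitone p h hg

/-- The homomorphism from `St(N)` taking an automorphism to its labels of level `N`. -/
noncomputable def levelLabels (N : ℕ) :
    levelFiltration (pAdicAut p) N →* Multiplicative (List (Fin p) → Fin p) :=
  MonoidHom.mk' (fun g => Multiplicative.ofAdd fun w => if w.length = N then lab g.1 w else 0)
    fun g h => by
      rw [← ofAdd_add]
      congr 1
      funext w
      by_cases hw : w.length = N
      · simp only [hw, if_true, Pi.add_apply, Subgroup.coe_mul, lab_mul]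
        rw [ap_eq_of_mem_level h.2 hw.le, add_comm]
      · simp [hw]

theorem ker_levelLabels (N : ℕ) :
    (levelLabels (p := p) N).ker =
      (levelFiltration (pAdicAut p) (N + 1)).subgroupOf (levelFiltration (pAdicAut p) N) := by
  ext g
  rw [MonoidHom.mem_ker, Subgroup.mem_subgroupOf, mem_level_iff]
  have h1 : levelLabels N g = 1 ↔ ∀ w : List (Fin p), w.length = N → lab g.1 w = 0 := by
    constructor
    · intro h w hw
      have := congrFun (congrArg Multiplicative.toAdd h) w
      simpa [levelLabels, hw] using this
    · intro h
      refine Multiplicative.toAdd.injective (funext fun w => ?_)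
      by_cases hw : w.length = N
      · simpa [levelLabels, hw] using h w hw
      · simp [levelLabels, hw]
  rw [h1]
  constructor
  · intro h w hw
    rcases Nat.lt_succ_iff_lt_or_eq.1 hw with h2 | h2
    · exact mem_level_iff.1 g.2 w h2
    · exact h w h2
  · exact fun h w hw => h w (by omega)

/-- The level-`N` labels of the elements of `K ∩ St(N)`. -/
noncomputable def labelGroup (K : Subgroup (pAdicAut p)) (N : ℕ) :
    AddSubgroup (List (Fin p) → Fin p) :=
  Subgroup.toAddSubgroup' (((levelFiltration (pAdicAut p) N ⊓ K).subgroupOf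
    (levelFiltration (pAdicAut p) N)).map (levelLabels N))

theorem mem_labelGroup {K : Subgroup (pAdicAut p)} {N : ℕ} {f : List (Fin p) → Fin p} :
    f ∈ labelGroup K N ↔ ∃ g ∈ K, g ∈ levelFiltration (pAdicAut p) N ∧
      ∀ w, f w = if w.length = N then lab g w else 0 := by
  constructor
  · rintro ⟨g, hg, hf⟩
    exact ⟨g.1, hg.2, g.2, fun w => (congrFun (congrArg Multiplicative.toAdd hf) w).symm⟩
  · rintro ⟨g, hg, hgN, hf⟩
    exact ⟨⟨g, hgN⟩, ⟨hgN, hg⟩, Multiplicative.toAdd.injective (funext fun w => (hf w).symm)⟩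

/-- The first isomorphism theorem identifies `(K ∩ St(N)) / (K ∩ St(N + 1))` with the label group.
-/
theorem relIndex_level_succ (K : Subgroup (pAdicAut p)) (N : ℕ) :
    (levelFiltration (pAdicAut p) (N + 1)).relIndex K =
      Nat.card (labelGroup K N) * (levelFiltration (pAdicAut p) N).relIndex K := by
  have h1 : levelFiltration (pAdicAut p) (N + 1) ⊓ levelFiltration (pAdicAut p) N =
      levelFiltration (pAdicAut p) (N + 1) :=
    inf_eq_left.2 (levelFiltration_antitone N.le_succ)
  have h2 := Subgroup.relIndex_ker
    ((K ⊓ levelFiltration (pAdicAut p) N).subgroupOf (levelFiltration (pAdicAut p) N))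
    (levelLabels (p := p) N)
  rw [ker_levelLabels, Subgroup.relIndex_subgroupOf inf_le_right, inf_comm] at h2
  rw [← h1, ← Subgroup.relIndex_inf_mul_relIndex, h2]
  rfl

theorem nsmul_ofNat_one (n : ℕ) : n • Fin.ofNat p 1 = Fin.ofNat p n := by
  induction n with
  | zero => ext; simp
  | succ n ih => rw [succ_nsmul, ih]; ext; simp [Fin.val_add]

theorem finite_and_card_le_of_support {X : Type*} {R : AddSubgroup (X → Fin p)} {Y : Finset X}
    (h : ∀ f ∈ R, ∀ x ∉ Y, f x = 0) : Finite R ∧ Nat.card R ≤ p ^ Y.card := by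
  have hinj : Function.Injective fun (f : R) (y : Y) => f.1 y.1 := by
    intro f g hfg
    refine Subtype.ext (funext fun x => ?_)
    by_cases hx : x ∈ Y
    · exact congrFun hfg ⟨x, hx⟩
    · rw [h _ f.2 x hx, h _ g.2 x hx]
  refine ⟨Finite.of_injective _ hinj, (Nat.card_le_card_of_injective _ hinj).trans (le_of_eq ?_)⟩
  rw [Nat.card_fun, Nat.card_fin, Nat.card_eq_finsetCard]

/-- Evaluation at the points `y j` recovers the coefficients of a combination of the `E i`, so
different coefficients give different elements. -/
theorem pow_card_le_of_dual {X ι : Type*} {R : AddSubgroup (X → Fin p)} [Finite R] {I : Finset ι}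
    (y : ι → X) (E : ι → X → Fin p) (hE : ∀ i ∈ I, E i ∈ R)
    (h1 : ∀ i ∈ I, E i (y i) = Fin.ofNat p 1) (h2 : ∀ i ∈ I, ∀ j ∈ I, i ≠ j → E i (y j) = 0) :
    p ^ I.card ≤ Nat.card R := by
  classical
  have hval : ∀ (f : I → Fin p) (j : I), (∑ i : I, (f i).val • E i.1) (y j.1) = f j := by
    intro f j
    rw [Finset.sum_apply, Finset.sum_eq_single j]
    · rw [Pi.smul_apply, h1 _ j.2, nsmul_ofNat_one, Fin.ofNat_val_eq_self]
    · intro i _ hij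
      rw [Pi.smul_apply, h2 _ i.2 _ j.2 fun h => hij (Subtype.ext h), smul_zero]
    · simp
  have hinj : Function.Injective fun f : I → Fin p =>
      (⟨∑ i : I, (f i).val • E i.1, sum_mem fun i _ => nsmul_mem (hE i.1 i.2) _⟩ : R) := by
    intro f g hfg
    funext j
    rw [← hval f j, ← hval g j]
    exact congrFun (congrArg Subtype.val hfg) _
  have := Nat.card_le_card_of_injective _ hinj
  simpa using this

/-- The words of length `N`. -/
def levelWords (p N : ℕ) : Finset (List (Fin p)) :=
  (Finset.univ : Finset (List.Vector (Fin p) N)).image List.Vector.toList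

theorem mem_levelWords {N : ℕ} {w : List (Fin p)} : w ∈ levelWords p N ↔ w.length = N := by
  simp only [levelWords, Finset.mem_image, Finset.mem_univ, true_and]
  exact ⟨fun ⟨v, hv⟩ => hv ▸ v.2, fun h => ⟨⟨w, h⟩, rfl⟩⟩

theorem card_levelWords (N : ℕ) : (levelWords p N).card = p ^ N := by
  rw [levelWords, Finset.card_image_of_injective _ List.Vector.toList_injective, Finset.card_univ,
    card_vector, Fintype.card_fin]

theorem labelGroup_support {K : Subgroup (pAdicAut p)} {N : ℕ} {f : List (Fin p) → Fin p}
    (hf : f ∈ labelGroup K N) {w : List (Fin p)} (hw : w ∉ levelWords p N) : f w = 0 := by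
  obtain ⟨g, -, -, h⟩ := mem_labelGroup.1 hf
  rw [h, if_neg fun h => hw (mem_levelWords.2 h)]

instance finite_labelGroup (K : Subgroup (pAdicAut p)) (N : ℕ) : Finite (labelGroup K N) :=
  (finite_and_card_le_of_support fun _ hf _ hw => labelGroup_support hf hw).1

theorem card_labelGroup_top (N : ℕ) :
    Nat.card (labelGroup (⊤ : Subgroup (pAdicAut p)) N) = p ^ p ^ N := by
  refine le_antisymm ?_ ?_
  · rw [← card_levelWords (p := p) N]
    exact (finite_and_card_le_of_support fun _ hf _ hw => labelGroup_support hf hw).2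
  · rw [← card_levelWords (p := p) N]
    classical
    refine pow_card_le_of_dual id (fun v w => if w = v then Fin.ofNat p 1 else 0) (fun v hv => ?_)
      (fun _ _ => if_pos rfl) fun v _ w _ hvw => if_neg hvw.symm
    rw [mem_levelWords] at hv
    refine mem_labelGroup.2 ⟨ofPortrait fun w => if w = v then Fin.ofNat p 1 else 0, trivial,
      mem_level_iff.2 fun w hw => ?_, fun w => ?_⟩
    · rw [lab_ofPortrait, if_neg]
      rintro rfl
      omega
    · rw [lab_ofPortrait]
      split_ifs with h1 h2 h2
      · rfl
      · exact absurd (h1 ▸ hv) h2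
      · rfl
      · rfl

open Classical in
/-- The words of length `N` having a prefix in `S`. -/
noncomputable def wordsBelow (S : Set (List (Fin p))) (N : ℕ) : Finset (List (Fin p)) :=
  (levelWords p N).filter fun w => ∃ v ∈ S, v <+: w

theorem mem_wordsBelow {S : Set (List (Fin p))} {N : ℕ} {w : List (Fin p)} :
    w ∈ wordsBelow S N ↔ w.length = N ∧ ∃ v ∈ S, v <+: w := by
  classical
  simp only [wordsBelow, Finset.mem_filter, mem_levelWords]

theorem card_labelGroup_le {S : Set (List (Fin p))} (hS : PrefixFree S)
    {K : Subgroup (pAdicAut p)} (hK : K ≤ (graftHom hS).range) (N : ℕ) :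
    Nat.card (labelGroup K N) ≤ p ^ (wordsBelow S N).card := by
  refine (finite_and_card_le_of_support fun f hf w hw => ?_).2
  obtain ⟨g, hg, -, h⟩ := mem_labelGroup.1 hf
  rw [h]
  split_ifs with hwN
  · obtain ⟨c, rfl⟩ := hK hg
    refine lab_graft_of_forall_not fun v hv hvw => hw ?_
    exact mem_wordsBelow.2 ⟨hwN, v, hv, hvw⟩
  · rfl

/-- Below `v`, differences of basis vectors whose numbers differ by `p ^ (N - v.length + 1 - h)` are
attained; each residue class modulo that power loses one dimension. The set `S'` is finite because
the level from which this holds depends on `v`. -/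
theorem le_card_labelGroup (hp : 2 ≤ p) {S : Set (List (Fin p))}
    {idx : ℕ → List (Fin p) × ℕ × ℕ} (hidx : Function.Surjective idx) (hS : PrefixFree S)
    {K : Subgroup (pAdicAut p)} (hA : genA S ∈ K) (hB : genB S idx ∈ K)
    {S' : Finset (List (Fin p))} (hS' : ↑S' ⊆ S) {h : ℕ} (hh : 0 < h) :
    ∀ᶠ N in atTop, p ^ ∑ v ∈ S', (p ^ (N - v.length) - p ^ (N - v.length + 1 - h)) ≤
      Nat.card (labelGroup K N) := by
  classical
  have hall : ∀ᶠ N in atTop, ∀ v ∈ S', v.length ≤ N ∧ ∀ u : List (Fin p),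
      v.length + u.length = N → ∃ g ∈ K, g ∈ levelFiltration (pAdicAut p) N ∧
        ∀ w : List (Fin p), w.length = N → lab g w =
          (if w = v ++ ap (odometer p ^ p ^ (u.length + 1 - h)) u then Fin.ofNat p 1 else 0)
            - if w = v ++ u then Fin.ofNat p 1 else 0 := by
    rw [Filter.eventually_all_finset]
    intro v hv
    obtain ⟨N₀, hN₀⟩ := exists_mem_level_lab hp hS hA hB hidx (hS' hv) hh
    filter_upwards [eventually_ge_atTop N₀, eventually_ge_atTop v.length] with N h1 h2
    exact ⟨h2, hN₀ N h1⟩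
  filter_upwards [hall] with N hN
  have hI : ∑ v ∈ S', (p ^ (N - v.length) - p ^ (N - v.length + 1 - h)) =
      (S'.sigma fun v => Finset.Ico (p ^ (N - v.length + 1 - h)) (p ^ (N - v.length))).card := by
    rw [Finset.card_sigma]
    simp
  rw [hI]
  set δ : List (Fin p) → List (Fin p) → Fin p := fun v w => if w = v then Fin.ofNat p 1 else 0
    with hδ
  have hstep : ∀ v ∈ S', ∀ q, δ (v ++ word p (N - v.length) (q + p ^ (N - v.length + 1 - h))) -
      δ (v ++ word p (N - v.length) q) ∈ labelGroup K N := by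
    intro v hv q
    obtain ⟨hvN, hv'⟩ := hN v hv
    obtain ⟨g, hg, hgN, hlab⟩ := hv' (word p (N - v.length) q) (by rw [length_word]; omega)
    refine mem_labelGroup.2 ⟨g, hg, hgN, fun w => ?_⟩
    rw [length_word, ap_odometer_pow_word] at hlab
    split_ifs with hw
    · exact (hlab w hw).symm
    · have hne : ∀ r, w ≠ v ++ word p (N - v.length) r := by
        rintro r rfl
        rw [List.length_append, length_word] at hw
        omega
      simp [hδ, hne]
  have hmul : ∀ v ∈ S', ∀ q r,
      δ (v ++ word p (N - v.length) (q + r * p ^ (N - v.length + 1 - h))) -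
        δ (v ++ word p (N - v.length) q) ∈ labelGroup K N := by
    intro v hv q r
    induction r with
    | zero => simp
    | succ r ih =>
      have := add_mem (hstep v hv (q + r * p ^ (N - v.length + 1 - h))) ih
      rwa [sub_add_sub_cancel, add_assoc q, ← Nat.succ_mul] at this
  have hinj : ∀ i ∈ S'.sigma fun v =>
      Finset.Ico (p ^ (N - v.length + 1 - h)) (p ^ (N - v.length)), ∀ v ∈ S',
      ∀ q < p ^ (N - v.length),
      i.1 ++ word p (N - i.1.length) i.2 = v ++ word p (N - v.length) q → i.1 = v ∧ i.2 = q := by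
    rintro ⟨v, q⟩ hi v' hv' q' hq' heq
    rw [Finset.mem_sigma, Finset.mem_Ico] at hi
    dsimp only at *
    obtain rfl : v = v' := hS.eq_of_prefix (hS' hi.1) (hS' hv')
      (List.prefix_append _ (word p (N - v.length) q)) (heq.symm ▸ List.prefix_append _ _)
    refine ⟨rfl, ?_⟩
    rw [List.append_cancel_left_eq, word_eq_word_iff] at heq
    exact heq.eq_of_lt_of_lt hi.2.2 hq'
  -- Each class is represented by its least residue; evaluation at the larger members is dual to
  -- their differences with it.
  refine pow_card_le_of_dual (fun i => i.1 ++ word p (N - i.1.length) i.2)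
    (fun i => δ (i.1 ++ word p (N - i.1.length) i.2) -
      δ (i.1 ++ word p (N - i.1.length) (i.2 % p ^ (N - i.1.length + 1 - h))))
    (fun i hi => ?_) (fun i hi => ?_) fun i hi j hj hij => ?_
  · have h1 := hmul i.1 (Finset.mem_sigma.1 hi).1 (i.2 % p ^ (N - i.1.length + 1 - h))
      (i.2 / p ^ (N - i.1.length + 1 - h))
    rwa [mul_comm, Nat.mod_add_div] at h1
  all_goals
    have hi' := Finset.mem_sigma.1 hi
    have hi2 := Finset.mem_Ico.1 hi'.2
    have hpos : 0 < p ^ (N - i.1.length + 1 - h) := Nat.pow_pos (by omega)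
    have hmod := Nat.mod_lt i.2 hpos
  · simp only [Pi.sub_apply, hδ, if_true]
    rw [if_neg, sub_zero]
    intro he
    have := (hinj i hi i.1 hi'.1 _ (by omega) he).2
    omega
  · have hj' := Finset.mem_sigma.1 hj
    have hj2 := Finset.mem_Ico.1 hj'.2
    simp only [Pi.sub_apply, hδ]
    rw [if_neg, if_neg, sub_zero]
    · intro he
      obtain ⟨h1, h2⟩ := hinj j hj i.1 hi'.1 _ (by omega) he
      rw [h1] at hj2
      omega
    · intro he
      obtain ⟨h1, h2⟩ := hinj j hj i.1 hi'.1 _ hi2.2 he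
      exact hij (Sigma.ext h1.symm (heq_of_eq h2.symm))

/-! ### Hausdorff dimension from level increments -/

theorem level_zero : levelFiltration (pAdicAut p) 0 = ⊤ :=
  eq_top_iff.2 fun _ _ => mem_level_iff.2 fun _ hv => absurd hv (Nat.not_lt_zero _)

theorem relIndex_level_zero (K : Subgroup (pAdicAut p)) :
    (levelFiltration (pAdicAut p) 0).relIndex K = 1 := by
  rw [level_zero, Subgroup.relIndex_top_left]

theorem relIndex_level_pos (K : Subgroup (pAdicAut p)) (N : ℕ) :
    0 < (levelFiltration (pAdicAut p) N).relIndex K := by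
  induction N with
  | zero => rw [relIndex_level_zero]; exact one_pos
  | succ N ih =>
    rw [relIndex_level_succ]
    exact Nat.mul_pos Nat.card_pos ih

theorem log_relIndex_level_succ (K : Subgroup (pAdicAut p)) (N : ℕ) :
    Real.log ((levelFiltration (pAdicAut p) (N + 1)).relIndex K) =
      Real.log ((levelFiltration (pAdicAut p) N).relIndex K) +
        Real.log (Nat.card (labelGroup K N)) := by
  rw [relIndex_level_succ, Nat.cast_mul, Real.log_mul, add_comm]
  · exact Nat.cast_ne_zero.2 Nat.card_pos.ne'
  · exact Nat.cast_ne_zero.2 (relIndex_level_pos K N).ne'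

theorem log_index_level_succ (N : ℕ) :
    Real.log ((levelFiltration (pAdicAut p) (N + 1)).index) =
      Real.log ((levelFiltration (pAdicAut p) N).index) + p ^ N * Real.log p := by
  rw [← Subgroup.relIndex_top_right, ← Subgroup.relIndex_top_right, log_relIndex_level_succ,
    card_labelGroup_top, Nat.cast_pow, Real.log_pow, Nat.cast_pow]

theorem hausdorffDim_eq_liminf (K : Subgroup (pAdicAut p)) :
    hausdorffDim (levelFiltration (pAdicAut p)) K =
      liminf (fun n => Real.log ((levelFiltration (pAdicAut p) n).relIndex K) /
        Real.log ((levelFiltration (pAdicAut p) n).index)) atTop := by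
  simp only [hausdorffDim, Subgroup.relIndex_sup_right]

theorem hausdorffDim_mem_Icc (K : Subgroup (pAdicAut p)) :
    hausdorffDim (levelFiltration (pAdicAut p)) K ∈ Set.Icc (0 : ℝ) 1 := by
  rw [hausdorffDim_eq_liminf]
  have h0 : ∀ n, 0 ≤ Real.log ((levelFiltration (pAdicAut p) n).relIndex K) /
      Real.log ((levelFiltration (pAdicAut p) n).index) := fun n =>
    div_nonneg (Real.log_natCast_nonneg _) (Real.log_natCast_nonneg _)
  have h1 : ∀ n, Real.log ((levelFiltration (pAdicAut p) n).relIndex K) /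
      Real.log ((levelFiltration (pAdicAut p) n).index) ≤ 1 := fun n => by
    -- At `n = 0` the denominator is `log 1 = 0` and the quotient is `0` by convention.
    refine div_le_one_of_le₀ ?_ (Real.log_natCast_nonneg _)
    refine Real.log_le_log (Nat.cast_pos.2 (relIndex_level_pos K n)) (Nat.cast_le.2 ?_)
    have h := relIndex_level_pos (⊤ : Subgroup (pAdicAut p)) n
    rw [Subgroup.relIndex_top_right] at h
    exact Nat.le_of_dvd h (Subgroup.relIndex_dvd_index_of_normal _ _)
  exact ⟨le_liminf_of_le (isCoboundedUnder_ge_of_le atTop h1) (Eventually.of_forall h0),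
    liminf_le_of_le (isBoundedUnder_of ⟨0, h0⟩) fun b hb => by
      obtain ⟨n, hn⟩ := hb.exists
      exact hn.trans (h1 n)⟩

theorem isOpen_level (n : ℕ) : IsOpen (levelFiltration (pAdicAut p) n : Set (pAdicAut p)) := by
  have h : IsOpen (AutTree.levelStabilizer p n : Set (AutTree p)) :=
    Subgroup.isOpen_of_mem_nhds _ (g := 1)
      ((AutTree.levelFilterBasis p).mem_nhds_one ⟨n, rfl⟩)
  exact h.preimage continuous_subtype_val

/-- The subgroup `K St(n)` is open, hence closed, so it contains the closure of `K`. -/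
theorem topologicalClosure_sup_level (K : Subgroup (pAdicAut p)) (n : ℕ) :
    K.topologicalClosure ⊔ levelFiltration (pAdicAut p) n = K ⊔ levelFiltration (pAdicAut p) n := by
  refine le_antisymm (sup_le ?_ le_sup_right) (sup_le_sup_right K.le_topologicalClosure _)
  have h : IsOpen ((K ⊔ levelFiltration (pAdicAut p) n : Subgroup (pAdicAut p)) :
      Set (pAdicAut p)) := Subgroup.isOpen_mono le_sup_right (isOpen_level n)
  exact K.topologicalClosure_minimal le_sup_left (Subgroup.isClosed_of_isOpen _ h)

theorem hausdorffDim_topologicalClosure (K : Subgroup (pAdicAut p)) :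
    hausdorffDim (levelFiltration (pAdicAut p)) K.topologicalClosure =
      hausdorffDim (levelFiltration (pAdicAut p)) K := by
  simp only [hausdorffDim, topologicalClosure_sup_level]

/-- A Stolz–Cesàro criterion. -/
theorem tendsto_div_of_increments {a w e : ℕ → ℝ} {α : ℝ} (ha : a 0 = 0) (hw : w 0 = 0)
    (hwe : ∀ n, w (n + 1) = w n + e n) (hwt : Tendsto w atTop atTop)
    (hup : ∀ n, a (n + 1) ≤ a n + α * e n)
    (hlow : ∀ ε > 0, ∀ᶠ n in atTop, a n + (α - ε) * e n ≤ a (n + 1)) :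
    Tendsto (fun n => a n / w n) atTop (𝓝 α) := by
  have hle : ∀ n, a n ≤ α * w n := by
    intro n
    induction n with
    | zero => rw [ha, hw, mul_zero]
    | succ n ih =>
      rw [hwe]
      linarith [hup n]
  rw [tendsto_order]
  refine ⟨fun b hb => ?_, fun b hb => ?_⟩
  -- The slope midway between `b` and `α` leaves room to absorb the error from the first `N` terms.
  · obtain ⟨N, hN⟩ := eventually_atTop.1 (hlow ((α - b) / 2) (by linarith))
    have hge : ∀ n ≥ N, a N - (α - (α - b) / 2) * w N + (α - (α - b) / 2) * w n ≤ a n := by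
      intro n hn
      induction n, hn using Nat.le_induction with
      | base => linarith
      | succ n hn ih =>
        rw [hwe]
        linarith [hN n hn]
    filter_upwards [eventually_ge_atTop N, hwt.eventually_gt_atTop 0,
      hwt.eventually_gt_atTop (((α - (α - b) / 2) * w N - a N) / ((α - b) / 2))] with n h1 h2 h3
    rw [lt_div_iff₀ h2]
    rw [div_lt_iff₀ (by linarith)] at h3
    linarith [hge n h1]
  · filter_upwards [hwt.eventually_gt_atTop 0] with n hn
    exact ((div_le_iff₀ hn).2 (hle n)).trans_lt hb

/-! ### Realising a prescribed dimension by digits -/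

/-- The words smaller than the expansion `d`, cut at the first difference. -/
def smallerWords (d : ℕ → Fin p) : Set (List (Fin p)) :=
  {w | ∃ n, ∃ x < d n, w = (List.range n).map d ++ [x]}

/-- A proper extension inside the set would follow `d` where the shorter word already deviates from
it. -/
theorem prefixFree_smallerWords (d : ℕ → Fin p) : PrefixFree (smallerWords d) := by
  rintro _ ⟨n, x, hx, rfl⟩ _ ⟨m, y, hy, rfl⟩ h
  have hl := h.length_le
  simp only [List.length_append, List.length_map, List.length_range, List.length_singleton] at hl
  rcases eq_or_lt_of_le (show n ≤ m by omega) with rfl | hnm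
  · exact h.eq_of_length (by simp)
  · exfalso
    have h1 : (List.range (n + 1)).map d <+: (List.range m).map d ++ [y] := by
      obtain ⟨k, rfl⟩ := Nat.exists_eq_add_of_le (Nat.succ_le_of_lt hnm)
      have h3 : List.range (n + 1) <+: List.range (n + 1 + k) := by
        rw [@List.range_add (n + 1) k]
        exact List.prefix_append _ _
      exact (h3.map d).trans (List.prefix_append _ _)
    have h2 := (List.prefix_of_prefix_length_le h h1 (by simp)).eq_of_length (by simp)
    rw [List.range_succ, List.map_append, List.append_cancel_left_eq] at h2
    simp only [List.map_cons, List.map_nil, List.cons.injEq, and_true] at h2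
    exact hx.ne h2

/-- The smaller words of length at most `L`. -/
def smallerWordsUpTo (d : ℕ → Fin p) (L : ℕ) : Finset (List (Fin p)) :=
  ((Finset.range L).sigma fun n => Finset.Iio (d n)).image fun i => (List.range i.1).map d ++ [i.2]

theorem smallerWordsUpTo_subset (d : ℕ → Fin p) (L : ℕ) :
    ↑(smallerWordsUpTo d L) ⊆ smallerWords d := by
  intro w hw
  obtain ⟨i, hi, rfl⟩ := Finset.mem_image.1 hw
  exact ⟨i.1, i.2, Finset.mem_Iio.1 (Finset.mem_sigma.1 hi).2, rfl⟩

theorem sum_smallerWordsUpTo (d : ℕ → Fin p) (L : ℕ) (f : ℕ → ℕ) :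
    ∑ v ∈ smallerWordsUpTo d L, f v.length = ∑ n ∈ Finset.range L, (d n).val * f (n + 1) := by
  rw [smallerWordsUpTo, Finset.sum_image, Finset.sum_sigma]
  · simp
  · rintro ⟨n, x⟩ - ⟨m, y⟩ - h
    dsimp only at h
    have hl := congrArg List.length h
    simp only [List.length_append, List.length_map, List.length_range,
      List.length_singleton, Nat.add_right_cancel_iff] at hl
    subst hl
    simpa using h

theorem card_wordsBelow_le (d : ℕ → Fin p) (N : ℕ) :
    (wordsBelow (smallerWords d) N).card ≤
      ∑ n ∈ Finset.range N, (d n).val * p ^ (N - (n + 1)) := by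
  rw [← sum_smallerWordsUpTo d N fun l => p ^ (N - l)]
  have hsub : wordsBelow (smallerWords d) N ⊆ (smallerWordsUpTo d N).biUnion fun v =>
      (levelWords p (N - v.length)).image (v ++ ·) := by
    intro w hw
    obtain ⟨hwN, v, ⟨n, x, hx, rfl⟩, t, rfl⟩ := mem_wordsBelow.1 hw
    rw [List.length_append] at hwN
    have hl : ((List.range n).map d ++ [x]).length = n + 1 := by simp
    refine Finset.mem_biUnion.2 ⟨_, Finset.mem_image.2 ⟨⟨n, x⟩, ?_, rfl⟩,
      Finset.mem_image.2 ⟨t, mem_levelWords.2 ?_, rfl⟩⟩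
    · exact Finset.mem_sigma.2 ⟨Finset.mem_range.2 (show n < N by omega), Finset.mem_Iio.2 hx⟩
    · dsimp only
      omega
  refine (Finset.card_le_card hsub).trans (Finset.card_biUnion_le.trans
    (Finset.sum_le_sum fun v _ => Finset.card_image_le.trans (card_levelWords _).le))

theorem sum_digits_eq (d : ℕ → Fin p) {L N : ℕ} (h : L ≤ N) :
    ∑ n ∈ Finset.range L, ((d n).val : ℝ) * (p : ℝ) ^ (N - (n + 1)) =
      p ^ N * ∑ n ∈ Finset.range L, Real.ofDigitsTerm d n := by
  have hp : (p : ℝ) ≠ 0 := Nat.cast_ne_zero.2 (NeZero.ne p)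
  rw [Finset.mul_sum]
  refine Finset.sum_congr rfl fun n hn => ?_
  have hn' := Finset.mem_range.1 hn
  rw [Real.ofDigitsTerm, pow_sub₀ _ hp (by omega)]
  ring

/-- The Hausdorff dimension of the group generated by `genA` and `genB`. -/
theorem hausdorffDim_closure_gen (hp : 2 ≤ p) (d : ℕ → Fin p)
    {idx : ℕ → List (Fin p) × ℕ × ℕ} (hidx : Function.Surjective idx) :
    hausdorffDim (levelFiltration (pAdicAut p))
      (Subgroup.closure {genA (smallerWords d), genB (smallerWords d) idx}) =
      Real.ofDigits d := by
  set S := smallerWords d with hSdef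
  have hS : PrefixFree S := prefixFree_smallerWords d
  set K := Subgroup.closure {genA S, genB S idx} with hK
  have hA : genA S ∈ K := Subgroup.subset_closure (Or.inl rfl)
  have hB : genB S idx ∈ K := Subgroup.subset_closure (Or.inr rfl)
  have hrange : K ≤ (graftHom hS).range := by
    rw [hK, Subgroup.closure_le]
    rintro g (rfl | rfl)
    · exact ⟨_, graftHom_apply hS _⟩
    · exact ⟨_, graftHom_apply hS _⟩
  have hp1 : (1 : ℝ) < p := by exact_mod_cast hp
  have hp0 : (0 : ℝ) < p := by linarith
  have hlog : 0 < Real.log p := Real.log_pos hp1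
  have hsum : HasSum (Real.ofDigitsTerm d) (Real.ofDigits d) :=
    Real.summable_ofDigitsTerm.hasSum
  have hpow : ∀ {m : ℕ}, Real.log ((p ^ m : ℕ) : ℝ) = m * Real.log p := fun {m} => by
    rw [Nat.cast_pow, Real.log_pow]
  rw [hausdorffDim_eq_liminf]
  refine (tendsto_div_of_increments (e := fun N => (p : ℝ) ^ N * Real.log p) ?_ ?_
    log_index_level_succ ?_ (fun N => ?_) fun ε hε => ?_).liminf_eq
  · rw [relIndex_level_zero, Nat.cast_one, Real.log_one]
  · rw [level_zero, Subgroup.index_top, Nat.cast_one, Real.log_one]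
  · refine tendsto_atTop_mono (f := fun n : ℕ => n * Real.log p) (fun n => ?_)
      (tendsto_natCast_atTop_atTop.atTop_mul_const hlog)
    induction n with
    | zero => simp [level_zero]
    | succ n ih =>
      rw [log_index_level_succ, Nat.cast_succ, add_mul]
      exact add_le_add ih (mul_le_mul_of_nonneg_right (one_le_pow₀ hp1.le) hlog.le)
  · rw [log_relIndex_level_succ]
    refine add_le_add_right ?_ _
    have h1 : Real.log (Nat.card (labelGroup K N)) ≤ (wordsBelow S N).card * Real.log p := by
      rw [← hpow]
      exact Real.log_le_log (Nat.cast_pos.2 Nat.card_pos)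
        (Nat.cast_le.2 (card_labelGroup_le hS hrange N))
    have h2 : ((wordsBelow S N).card : ℝ) ≤ p ^ N * Real.ofDigits d := by
      have h3 : ((wordsBelow S N).card : ℝ) ≤
          ∑ n ∈ Finset.range N, ((d n).val : ℝ) * (p : ℝ) ^ (N - (n + 1)) := by
        exact_mod_cast card_wordsBelow_le d N
      rw [sum_digits_eq d le_rfl] at h3
      refine h3.trans (mul_le_mul_of_nonneg_left ?_ (by positivity))
      exact sum_le_hasSum _ (fun _ _ => Real.ofDigitsTerm_nonneg) hsum
    calc _ ≤ _ := h1
      _ ≤ _ := mul_le_mul_of_nonneg_right h2 hlog.le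
      _ = _ := by ring
  · obtain ⟨L, hL⟩ := ((tendsto_order.1 hsum.tendsto_sum_nat).1
      (Real.ofDigits d - ε / 2) (by linarith)).exists
    -- The error is shared: truncating the digits at `L` costs less than `ε / 2`, and spacing `h = k
    -- + 1` loses a proportion `p ^ (-k) < ε / 2` of a sum that is at most `1`.
    obtain ⟨k, hk⟩ := exists_pow_lt_of_lt_one (show 0 < ε / 2 by linarith) (inv_lt_one_of_one_lt₀ hp1)
    have hS' := smallerWordsUpTo_subset d L
    filter_upwards [le_card_labelGroup hp hidx hS hA hB hS' (Nat.succ_pos k),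
      eventually_ge_atTop (L + k + 1)] with N h1 h2
    rw [log_relIndex_level_succ]
    refine add_le_add_right ?_ _
    rw [sum_smallerWordsUpTo d L fun l => p ^ (N - l) - p ^ (N - l + 1 - (k + 1))] at h1
    have h3 := Real.log_le_log (by positivity) (Nat.cast_le (α := ℝ).2 h1)
    rw [hpow] at h3
    refine le_trans ?_ h3
    rw [← mul_assoc]
    refine mul_le_mul_of_nonneg_right ?_ hlog.le
    have h4 : ((∑ n ∈ Finset.range L, (d n).val *
        (p ^ (N - (n + 1)) - p ^ (N - (n + 1) + 1 - (k + 1))) : ℕ) : ℝ) =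
        (∑ n ∈ Finset.range L, ((d n).val : ℝ) * (p : ℝ) ^ (N - (n + 1))) * (1 - (p : ℝ)⁻¹ ^ k) := by
      rw [Nat.cast_sum, Finset.sum_mul]
      refine Finset.sum_congr rfl fun n hn => ?_
      have hn' := Finset.mem_range.1 hn
      rw [Nat.cast_mul, Nat.cast_sub (Nat.pow_le_pow_right (by omega) (by omega)),
        Nat.add_sub_add_right, Nat.cast_pow, Nat.cast_pow, pow_sub₀ _ hp0.ne' (by omega : k ≤ _),
        inv_pow]
      ring
    rw [h4, sum_digits_eq d (by omega), mul_comm (Real.ofDigits d - ε), mul_assoc]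
    refine mul_le_mul_of_nonneg_left ?_ (by positivity)
    have h5 : ∑ n ∈ Finset.range L, Real.ofDigitsTerm d n ≤ 1 :=
      (sum_le_hasSum _ (fun _ _ => Real.ofDigitsTerm_nonneg) hsum).trans (Real.ofDigits_le_one d)
    have h6 : 0 ≤ ∑ n ∈ Finset.range L, Real.ofDigitsTerm d n :=
      Finset.sum_nonneg fun _ _ => Real.ofDigitsTerm_nonneg
    nlinarith

theorem exists_hausdorffDim_eq (hp : 2 ≤ p) {α : ℝ} (hα : α ∈ Set.Icc (0 : ℝ) 1) :
    ∃ g h : pAdicAut p, hausdorffDim (levelFiltration (pAdicAut p))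
      (Subgroup.closure {g, h}).topologicalClosure = α := by
  obtain ⟨d, -, rfl⟩ := Real.ofDigits_SurjOn (b := p) (by omega) hα
  obtain ⟨idx, hidx⟩ := exists_surjective_nat (List (Fin p) × ℕ × ℕ)
  exact ⟨_, _, (hausdorffDim_topologicalClosure _).trans (hausdorffDim_closure_gen hp d hidx)⟩

end PAdicAut

theorem mainTheorem5 (p : ℕ) (hp : p.Prime) :
    boundedHausdorffSpectrum (levelFiltration (pAdicAut p)) 2 = Set.Icc (0 : ℝ) 1 ∧
      ∀ α ∈ Set.Icc (0 : ℝ) 1, ∃ g h : pAdicAut p,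
        hausdorffDim (levelFiltration (pAdicAut p))
          (Subgroup.closure {g, h}).topologicalClosure = α := by
  have : NeZero p := ⟨hp.ne_zero⟩
  have key : ∀ α ∈ Set.Icc (0 : ℝ) 1, ∃ g h : pAdicAut p,
      hausdorffDim (levelFiltration (pAdicAut p))
        (Subgroup.closure {g, h}).topologicalClosure = α :=
    fun α hα => PAdicAut.exists_hausdorffDim_eq hp.two_le hα
  refine ⟨Set.Subset.antisymm ?_ fun α hα => ?_, key⟩
  · rintro _ ⟨K, -, -, rfl⟩
    exact PAdicAut.hausdorffDim_mem_Icc K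
  · classical
    obtain ⟨g, h, hgh⟩ := key α hα
    refine ⟨_, Subgroup.isClosed_topologicalClosure _, ⟨{g, h}, Finset.card_le_two, ?_⟩, hgh⟩
    rw [Finset.coe_pair]
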